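/- **Theorem (Uniqueness of 1-D solutions).** Let $p\colon(0,\infty)\to\mathbb R$ be any differentiable function with $p>0$ and $p'>0$ on $(0,\infty)$, and let $\epsilon\colon(0,\infty)\to\mathbb R$ be a corresponding internal energy, i.e. $p(r)=r^2\epsilon'(r)$ for all $r>0$. Let $(\rho_\pm,v_{\pm1},v_{\pm2})$ be constants with $\rho_+=\rho_->0$, $v_{+2}=v_{-2}$ and $v_{+1}\neq v_{-1}$, and put $$(\rho^0,v^0)(x)=\begin{cases}(\rho_-,v_-)& x_2<0,\\(\rho_+,v_+)& x_2>0,\end{cases}\qquad x=(x_1,x_2)\in\mathbb R^2 .$$ Let $(\rho,v)=(\rho,v_1,v_2)\in L^\infty(\mathbb R^2\times[0,\infty))$ be an admissible weak solution of the isentropic compressible Euler system with these initial data, i.e. for every $\varphi\in C_c^\infty(\mathbb R^2\times[0,\infty))$ and $i=1,2$, $$\int_0^\infty\!\!\int_{\mathbb R^2}\big[\rho\,\partial_t\varphi+\rho v\cdot\nabla_x\varphi\big]\,dx\,dt+\int_{\mathbb R^2}\rho^0\varphi(x,0)\,dx=0,$$ $$\int_0^\infty\!\!\int_{\mathbb R^2}\big[\rho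 v_i\,\partial_t\varphi+\rho v_i\,v\cdot\nabla_x\varphi+p(\rho)\,\partial_{x_i}\varphi\big]\,dx\,dt+\int_{\mathbb R^2}\rho^0v^0_i\,\varphi(x,0)\,dx=0,$$ and for every nonnegative $\varphi\in C_c^\infty(\mathbb R^2\times[0,\infty))$, $$\int_0^\infty\!\!\int_{\mathbb R^2}\Big[\Big(\rho\epsilon(\rho)+\rho\tfrac{|v|^2}{2}\Big)\partial_t\varphi+\Big(\rho\epsilon(\rho)+\rho\tfrac{|v|^2}{2}+p(\rho)\Big)v\cdot\nabla_x\varphi\Big]dx\,dt+\int_{\mathbb R^2}\Big(\rho^0\epsilon(\rho^0)+\rho^0\tfrac{|v^0|^2}{2}\Big)\varphi(x,0)\,dx\ \ge 0 .$$ Assume moreover that the (essential) infimum of $\rho$ is positive and that $(\rho,v_1,v_2)$ depends on $x$ only through $x_2$, i.e. is a function of $(x_2,t)$ only. Then $(\rho,v_1,v_2)$ is the classical self-similar solution with a single contact discontinuity: for almost every $(x,t)\in\mathbb R^2\times(0,\infty)$, $$(\rho,v)(x,t)=\begin{cases}(\rho_-,v_-)& x_2<v_{-2}\,t,\\(\rho_+,v_+)&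 x_2>v_{-2}\,t.\end{cases}$$ -/

import Mathlib

open MeasureTheory Set
open scoped ContDiff

namespace IsentropicEuler

/-- The plane `ℝ²`; a point is `x = (x₁, x₂)`. -/
abbrev Plane := ℝ × ℝ

/-- Space-time; a point is `z = (x, t)`, so `z.1.1 = x₁`, `z.1.2 = x₂`, `z.2 = t`. -/
abbrev SpaceTime := Plane × ℝ

/-- The region `ℝ² × (0, ∞)`. -/
def upper : Set SpaceTime := {z | 0 < z.2}

/-- Lebesgue measure on `ℝ² × (0, ∞)`. -/
noncomputable def upperMeasure : Measure SpaceTime := volume.restrict upper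

/-- The partial derivative `∂φ/∂t`. -/
noncomputable def dt (φ : SpaceTime → ℝ) (z : SpaceTime) : ℝ := fderiv ℝ φ z ((0, 0), 1)

/-- The partial derivative `∂φ/∂x₁`. -/
noncomputable def dx₁ (φ : SpaceTime → ℝ) (z : SpaceTime) : ℝ := fderiv ℝ φ z ((1, 0), 0)

/-- The partial derivative `∂φ/∂x₂`. -/
noncomputable def dx₂ (φ : SpaceTime → ℝ) (z : SpaceTime) : ℝ := fderiv ℝ φ z ((0, 1), 0)

/-- Test functions in `C_c^∞(ℝ² × [0, ∞))`, given as smooth compactly supported functions on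
`ℝ² × ℝ` of which only the restriction to `t ≥ 0` is used. -/
def IsTest (φ : SpaceTime → ℝ) : Prop := ContDiff ℝ ∞ φ ∧ HasCompactSupport φ

/-- A pressure law on `(0, ∞)` with `p > 0` and `p' > 0`. -/
def IsPressureLaw (p : ℝ → ℝ) : Prop :=
  ∀ r : ℝ, 0 < r → 0 < p r ∧ DifferentiableAt ℝ p r ∧ 0 < deriv p r

/-- `ε` is an internal energy for `p`: `p(r) = r² ε'(r)` on `(0, ∞)`. -/
def IsInternalEnergy (p ε : ℝ → ℝ) : Prop :=
  ∀ r : ℝ, 0 < r → DifferentiableAt ℝ ε r ∧ p r = r ^ 2 * deriv ε r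

/-- Values of density and of the two velocity components. -/
structure State where
  ρ : ℝ
  v₁ : ℝ
  v₂ : ℝ

/-- The energy `ρ ε(ρ) + ρ |v|² / 2`. -/
noncomputable def energy (ε : ℝ → ℝ) (s : State) : ℝ :=
  s.ρ * ε s.ρ + s.ρ * ((s.v₁ ^ 2 + s.v₂ ^ 2) / 2)

/-- `U` and its components are in `L^∞(ℝ² × [0, ∞))`. -/
def Bounded (U : SpaceTime → State) : Prop :=
  MemLp (fun z => (U z).ρ) ⊤ upperMeasure ∧
  MemLp (fun z => (U z).v₁) ⊤ upperMeasure ∧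
  MemLp (fun z => (U z).v₂) ⊤ upperMeasure

/-- The (essential) infimum of the density over `ℝ² × [0, ∞)` is positive. -/
def DensityBoundedBelow (U : SpaceTime → State) : Prop :=
  ∃ c : ℝ, 0 < c ∧ ∀ᵐ z ∂upperMeasure, c ≤ (U z).ρ

/-- `U` is (almost everywhere) a function of `x₂` and `t` only. -/
def IsOneDimensional (U : SpaceTime → State) : Prop :=
  ∃ W : ℝ → ℝ → State, ∀ᵐ z ∂upperMeasure, U z = W z.1.2 z.2

/-- `∂ₜ ρ + div(ρ v) = 0` in the sense of distributions, with initial data `U₀`. -/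
def WeakMass (U₀ : Plane → State) (U : SpaceTime → State) : Prop :=
  ∀ φ : SpaceTime → ℝ, IsTest φ →
    (∫ z, ((U z).ρ * dt φ z
        + (U z).ρ * ((U z).v₁ * dx₁ φ z + (U z).v₂ * dx₂ φ z)) ∂upperMeasure)
      + ∫ x : Plane, (U₀ x).ρ * φ (x, 0) = 0

/-- First component of `∂ₜ(ρ v) + div(ρ v ⊗ v) + ∇ p(ρ) = 0` in the sense of distributions,
with initial data `U₀`. -/
def WeakMomentum₁ (p : ℝ → ℝ) (U₀ : Plane → State) (U : SpaceTime → State) : Prop :=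
  ∀ φ : SpaceTime → ℝ, IsTest φ →
    (∫ z, ((U z).ρ * (U z).v₁ * dt φ z
        + (U z).ρ * (U z).v₁ * ((U z).v₁ * dx₁ φ z + (U z).v₂ * dx₂ φ z)
        + p (U z).ρ * dx₁ φ z) ∂upperMeasure)
      + ∫ x : Plane, (U₀ x).ρ * (U₀ x).v₁ * φ (x, 0) = 0

/-- Second component of `∂ₜ(ρ v) + div(ρ v ⊗ v) + ∇ p(ρ) = 0` in the sense of distributions,
with initial data `U₀`. -/
def WeakMomentum₂ (p : ℝ → ℝ) (U₀ : Plane → State) (U : SpaceTime → State) : Prop :=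
  ∀ φ : SpaceTime → ℝ, IsTest φ →
    (∫ z, ((U z).ρ * (U z).v₂ * dt φ z
        + (U z).ρ * (U z).v₂ * ((U z).v₁ * dx₁ φ z + (U z).v₂ * dx₂ φ z)
        + p (U z).ρ * dx₂ φ z) ∂upperMeasure)
      + ∫ x : Plane, (U₀ x).ρ * (U₀ x).v₂ * φ (x, 0) = 0

/-- The entropy (energy) inequality in the sense of distributions, with initial data `U₀`. -/
def EntropyInequality (p ε : ℝ → ℝ) (U₀ : Plane → State) (U : SpaceTime → State) : Prop :=
  ∀ φ : SpaceTime → ℝ, IsTest φ → (∀ z : SpaceTime, 0 ≤ z.2 → 0 ≤ φ z) →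
    0 ≤ (∫ z, (energy ε (U z) * dt φ z
          + (energy ε (U z) + p (U z).ρ)
            * ((U z).v₁ * dx₁ φ z + (U z).v₂ * dx₂ φ z)) ∂upperMeasure)
        + ∫ x : Plane, energy ε (U₀ x) * φ (x, 0)

/-- Bounded admissible weak solutions of the 2-D isentropic compressible Euler system with
pressure `p`, internal energy `ε` and initial data `U₀`. -/
structure IsAdmissibleWeakSolution (p ε : ℝ → ℝ) (U₀ : Plane → State)
    (U : SpaceTime → State) : Prop where
  bounded : Bounded U
  mass : WeakMass U₀ U
  momentum₁ : WeakMomentum₁ p U₀ U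
  momentum₂ : WeakMomentum₂ p U₀ U
  entropy : EntropyInequality p ε U₀ U

/-- Riemann data: `sL` for `x₂ < 0`, `sR` for `x₂ > 0` (the line `x₂ = 0` is a null set). -/
noncomputable def riemannData (sL sR : State) (x : Plane) : State :=
  if x.2 < 0 then sL else sR

/-- The self-similar solution with a single discontinuity, along `x₂ = c t`, separating the
constant states `sL` and `sR` (the interface is a null set). It is the classical contact
discontinuity when `c` is the common normal velocity. -/
noncomputable def singleJump (sL sR : State) (c : ℝ) (z : SpaceTime) : State :=
  if z.1.2 < c * z.2 then sL else sR

end IsentropicEuler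

open Filter Topology

namespace IsentropicEuler

/-! Let `r`, `w`, `v` be density, tangential and normal velocity as functions of (y, t) = (x₂, t);
let ρ₀, V be the common density and normal velocity of the data, and a, b its two tangential
velocities.

The equation ∂ₜr + ∂_y(rv) = 0 makes (r, -rv) the gradient of a function ψ, the Lagrangian mass
coordinate. As r lies between positive constants, ψ is Lipschitz and strictly increasing in y with
slope at least c, so (ψ, t) are global coordinates. The tangential momentum equation says that w is
transported by the flow, that is, constant in time in these coordinates. So w = a where ψ ≤ 0 and w
= b where ψ > 0 (`IsMassPair.ae_eq_jump`, `IsPlanarSolution.ae_w_eq`). The velocity field is merely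
bounded; the change of variables is justified by mollifying ψ, whose derivatives are then the
mollified r and -rv (`IsMassPair.integral_transported`).

Since w takes only the values a and b, w² = (a + b)w - ab. The tangential kinetic energy rw²/2 is
therefore a linear combination of the conserved quantities rw and r, and drops out of the energy
inequality. What remains is ∂ₜE + ∂_yQ ≤ 0 with zero initial values, where E is the energy of (r, v)
relative to the constant state (ρ₀, V) (`IsPlanarSolution.relE_inequality`). From p' > 0 one gets E
≥ 0, with E = 0 only at (ρ₀, V), and |Q| ≤ L E (`exists_relEnergy_bound`). Testing on backward cones
gives E = 0 (`ae_eq_zero_of_finite_speed`). So r = ρ₀ and v = V, whence ψ = ρ₀(y - Vt), and the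
formula for w puts its jump on y = Vt. -/

/-- Test functions on the plane of points `(y, t)`. -/
def IsTest₂ (φ : ℝ × ℝ → ℝ) : Prop := ContDiff ℝ ∞ φ ∧ HasCompactSupport φ

/-- The partial derivative in the first variable. -/
noncomputable def dy (φ : ℝ × ℝ → ℝ) (q : ℝ × ℝ) : ℝ := fderiv ℝ φ q (1, 0)

/-- The partial derivative in the second variable. -/
noncomputable def dτ (φ : ℝ × ℝ → ℝ) (q : ℝ × ℝ) : ℝ := fderiv ℝ φ q (0, 1)

/-- The half-plane `t > 0`. -/
def upper₂ : Set (ℝ × ℝ) := {q | 0 < q.2}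

theorem measurableSet_upper₂ : MeasurableSet upper₂ :=
  measurableSet_lt measurable_const measurable_snd

/-! ### Slices of test functions and integration by parts on half-planes -/

theorem hasDerivAt_fst_slice {φ : ℝ × ℝ → ℝ} (h : Differentiable ℝ φ) (y t : ℝ) :
    HasDerivAt (fun x => φ (x, t)) (dy φ (y, t)) y := by
  have h1 : HasDerivAt (fun x : ℝ => (x, t)) ((1 : ℝ), (0 : ℝ)) y :=
    (hasDerivAt_id y).prodMk (hasDerivAt_const y t)
  exact (h (y, t)).hasFDerivAt.comp_hasDerivAt y h1

theorem hasDerivAt_snd_slice {φ : ℝ × ℝ → ℝ} (h : Differentiable ℝ φ) (y t : ℝ) :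
    HasDerivAt (fun s => φ (y, s)) (dτ φ (y, t)) t := by
  have h1 : HasDerivAt (fun s : ℝ => (y, s)) ((0 : ℝ), (1 : ℝ)) t :=
    (hasDerivAt_const t y).prodMk (hasDerivAt_id t)
  exact (h (y, t)).hasFDerivAt.comp_hasDerivAt t h1

namespace IsTest₂

variable {φ : ℝ × ℝ → ℝ}

theorem differentiable (h : IsTest₂ φ) : Differentiable ℝ φ := h.1.differentiable (by simp)

theorem continuous (h : IsTest₂ φ) : Continuous φ := h.1.continuous

theorem dy (h : IsTest₂ φ) : IsTest₂ (dy φ) :=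
  ⟨(h.1.fderiv_right (m := ∞) (by simp)).clm_apply contDiff_const, h.2.fderiv_apply ℝ _⟩

theorem dτ (h : IsTest₂ φ) : IsTest₂ (dτ φ) :=
  ⟨(h.1.fderiv_right (m := ∞) (by simp)).clm_apply contDiff_const, h.2.fderiv_apply ℝ _⟩

end IsTest₂

theorem hasCompactSupport_bound {φ : ℝ × ℝ → ℝ} (h : HasCompactSupport φ) :
    ∃ A : ℝ, 0 ≤ A ∧ ∀ q, φ q ≠ 0 → |q.1| ≤ A ∧ |q.2| ≤ A := by
  obtain ⟨A, hA⟩ := h.isBounded.exists_norm_le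
  refine ⟨max A 0, le_max_right _ _, fun q hq => ?_⟩
  have := hA q (subset_tsupport φ hq)
  rw [Prod.norm_def, max_le_iff] at this
  exact ⟨this.1.trans (le_max_left _ _), this.2.trans (le_max_left _ _)⟩

/-- A continuous compactly supported function on the plane restricts to one on each vertical
line. -/
theorem hasCompactSupport_slice_snd {φ : ℝ × ℝ → ℝ} (h : HasCompactSupport φ) (y : ℝ) :
    HasCompactSupport (fun t => φ (y, t)) := by
  obtain ⟨A, -, hA⟩ := hasCompactSupport_bound h
  refine HasCompactSupport.intro (K := Icc (-A) A) isCompact_Icc fun t ht => ?_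
  by_contra h0
  exact ht (abs_le.1 (hA _ h0).2)

theorem hasCompactSupport_slice_fst {φ : ℝ × ℝ → ℝ} (h : HasCompactSupport φ) (t : ℝ) :
    HasCompactSupport (fun y => φ (y, t)) := by
  obtain ⟨A, -, hA⟩ := hasCompactSupport_bound h
  refine HasCompactSupport.intro (K := Icc (-A) A) isCompact_Icc fun y hy => ?_
  by_contra h0
  exact hy (abs_le.1 (hA _ h0).1)

/-- A bounded measurable function times a continuous compactly supported one is integrable. -/
theorem integrable_bdd_mul {X : Type*} [TopologicalSpace X] [MeasurableSpace X] [BorelSpace X]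
    [SecondCountableTopology X]
    {μ : Measure X} [IsFiniteMeasureOnCompacts μ] {g φ : X → ℝ} {M : ℝ} (hg : Measurable g)
    (hM : ∀ x, |g x| ≤ M) (hφ : Continuous φ) (hc : HasCompactSupport φ) :
    Integrable (fun x => g x * φ x) μ :=
  (hφ.integrable_of_hasCompactSupport hc).bdd_mul hg.aestronglyMeasurable (.of_forall hM)

theorem integral_upper₂ {F : ℝ × ℝ → ℝ} (hF : IntegrableOn F upper₂) :
    ∫ q in upper₂, F q = ∫ y, ∫ t in Ioi 0, F (y, t) := by
  have h : upper₂ = univ ×ˢ Ioi (0 : ℝ) := by ext; simp [upper₂]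
  rw [h] at hF ⊢
  rw [Measure.volume_eq_prod, setIntegral_prod _ hF]
  simp

theorem integral_upper₂_dτ {φ : ℝ × ℝ → ℝ} (hφ : IsTest₂ φ) {g : ℝ → ℝ} {M : ℝ}
    (hg : Measurable g) (hM : ∀ x, |g x| ≤ M) :
    ∫ q in upper₂, g q.1 * dτ φ q = - ∫ y, g y * φ (y, 0) := by
  have hi : Integrable (fun q : ℝ × ℝ => g q.1 * dτ φ q) :=
    integrable_bdd_mul (hg.comp measurable_fst) (fun x => hM _) hφ.dτ.continuous hφ.dτ.2
  rw [integral_upper₂ hi.integrableOn, ← integral_neg]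
  congr 1
  ext y
  dsimp only
  rw [integral_const_mul]
  have h1 : ContDiff ℝ 1 (fun t => φ (y, t)) :=
    (hφ.1.of_le (by simp)).comp (contDiff_const.prodMk contDiff_id)
  have := HasCompactSupport.integral_Ioi_deriv_eq h1 (hasCompactSupport_slice_snd hφ.2 y) 0
  have h2 : ∀ t, deriv (fun t => φ (y, t)) t = dτ φ (y, t) :=
    fun t => (hasDerivAt_snd_slice hφ.differentiable y t).deriv
  simp only [h2] at this
  rw [this]
  ring

/-- The integral over the whole plane vanishes, so the lower half-plane carries the opposite of the
upper one. This is what lets initial data be encoded by extending a solution constantly in time to t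
≤ 0. -/
theorem integral_lower₂_dτ {φ : ℝ × ℝ → ℝ} (hφ : IsTest₂ φ) {g : ℝ → ℝ} {M : ℝ}
    (hg : Measurable g) (hM : ∀ x, |g x| ≤ M) :
    ∫ q in upper₂ᶜ, g q.1 * dτ φ q = ∫ y, g y * φ (y, 0) := by
  have hi : Integrable (fun q : ℝ × ℝ => g q.1 * dτ φ q) :=
    integrable_bdd_mul (hg.comp measurable_fst) (fun x => hM _) hφ.dτ.continuous hφ.dτ.2
  have hz : ∫ q : ℝ × ℝ, g q.1 * dτ φ q = 0 := by
    rw [Measure.volume_eq_prod] at hi ⊢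
    rw [integral_prod _ hi]
    refine integral_eq_zero_of_ae (.of_forall fun y => ?_)
    dsimp only [Pi.zero_apply]
    rw [integral_const_mul, integral_eq_zero_of_hasDerivAt_of_integrable
      (f := fun t => φ (y, t)) (fun t => hasDerivAt_snd_slice hφ.differentiable y t), mul_zero]
    · exact (hφ.dτ.continuous.comp (by fun_prop)).integrable_of_hasCompactSupport
        (hasCompactSupport_slice_snd hφ.dτ.2 y)
    · exact (hφ.continuous.comp (by fun_prop)).integrable_of_hasCompactSupport
        (hasCompactSupport_slice_snd hφ.2 y)
  have := integral_add_compl measurableSet_upper₂ hi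
  rw [hz, integral_upper₂_dτ hφ hg hM] at this
  linarith

theorem integral_upper₂_dy {φ : ℝ × ℝ → ℝ} (hφ : IsTest₂ φ) :
    ∫ q in upper₂, dy φ q = 0 := by
  have hi : Integrable (dy φ) := hφ.dy.continuous.integrable_of_hasCompactSupport hφ.dy.2
  have h : upper₂ = univ ×ˢ Ioi (0 : ℝ) := by ext; simp [upper₂]
  have hi' := hi.integrableOn (s := upper₂)
  rw [h] at hi' ⊢
  rw [Measure.volume_eq_prod, ← Measure.prod_restrict, integral_prod_symm]
  · refine integral_eq_zero_of_ae (.of_forall fun t => ?_)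
    rw [Measure.restrict_univ]
    apply integral_eq_zero_of_hasDerivAt_of_integrable (f := fun y => φ (y, t))
      (fun y => hasDerivAt_fst_slice hφ.differentiable y t)
    · exact (hφ.dy.continuous.comp (by fun_prop)).integrable_of_hasCompactSupport
        (hasCompactSupport_slice_fst hφ.dy.2 t)
    · exact (hφ.continuous.comp (by fun_prop)).integrable_of_hasCompactSupport
        (hasCompactSupport_slice_fst hφ.2 t)
  · rw [Measure.prod_restrict]
    exact hi'

/-! ### Time antiderivatives of test functions -/

/-- A smooth cut-off in time, equal to `1` for `t ≥ -1` and to `0` for `t ≤ -2`. -/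
noncomputable def timeCutoff (t : ℝ) : ℝ := Real.smoothTransition (t + 2)

theorem timeCutoff_contDiff : ContDiff ℝ ∞ timeCutoff :=
  Real.smoothTransition.contDiff.comp (contDiff_id.add contDiff_const)

theorem timeCutoff_eq_one {t : ℝ} (h : -1 ≤ t) : timeCutoff t = 1 :=
  Real.smoothTransition.one_of_one_le (by linarith)

theorem timeCutoff_eq_zero {t : ℝ} (h : t ≤ -2) : timeCutoff t = 0 :=
  Real.smoothTransition.zero_of_nonpos (by linarith)

/-- The integral of `κ` over the half-line above `q`. -/
noncomputable def tail (κ : ℝ × ℝ → ℝ) (q : ℝ × ℝ) : ℝ := ∫ t in Ioi q.2, κ (q.1, t)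

theorem hasCompactSupport_of_bound {φ : ℝ × ℝ → ℝ} {A : ℝ}
    (h : ∀ q, φ q ≠ 0 → |q.1| ≤ A ∧ |q.2| ≤ A) : HasCompactSupport φ := by
  apply HasCompactSupport.intro (K := Icc (-A) A ×ˢ Icc (-A) A)
    (isCompact_Icc.prod isCompact_Icc)
  intro q hq
  by_contra h0
  have := h q h0
  rw [abs_le, abs_le] at this
  exact hq ⟨this.1, this.2⟩

/-- The tail is the convolution in t of κ with the indicator of (-∞, 0), with y as a parameter;
smoothness in both variables jointly comes from the parametric convolution theorem. -/
theorem tail_contDiff {κ : ℝ × ℝ → ℝ} (h : IsTest₂ κ) : ContDiff ℝ ∞ (tail κ) := by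
  obtain ⟨A, hA0, hA⟩ := hasCompactSupport_bound h.2
  have hf : LocallyIntegrable ((Iio (0 : ℝ)).indicator fun _ => (1 : ℝ)) volume :=
    (locallyIntegrable_const 1).indicator measurableSet_Iio
  have := contDiffOn_convolution_right_with_param (n := ⊤) (μ := volume) (𝕜 := ℝ)
    (ContinuousLinearMap.lsmul ℝ ℝ) (g := fun y t => κ (y, t)) (s := univ) (k := Icc (-A) A)
    isOpen_univ isCompact_Icc (by
      intro y t _ ht
      by_contra h0
      exact ht (abs_le.1 (hA _ h0).2)) hf (by
      have : (↿fun y t => κ (y, t)) = κ := rfl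
      rw [this]
      exact h.1.contDiffOn)
  rw [univ_prod_univ, contDiffOn_univ] at this
  convert this using 2 with q
  rw [MeasureTheory.convolution_def, tail]
  simp only [ContinuousLinearMap.lsmul_apply, smul_eq_mul]
  rw [← integral_indicator measurableSet_Ioi, ← integral_sub_left_eq_self _ volume q.2]
  congr 1
  ext t
  by_cases ht : t < 0
  · rw [indicator_of_mem (by rw [mem_Ioi]; linarith), indicator_of_mem (by simpa using ht)]; simp
  · rw [indicator_of_notMem (by rw [mem_Ioi]; linarith), indicator_of_notMem (by simpa using ht)]
    simp

theorem tail_dτ {φ : ℝ × ℝ → ℝ} (h : IsTest₂ φ) (q : ℝ × ℝ) : tail (dτ φ) q = - φ q := by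
  have h1 : ContDiff ℝ 1 (fun t => φ (q.1, t)) :=
    (h.1.of_le (by simp)).comp (contDiff_const.prodMk contDiff_id)
  have := HasCompactSupport.integral_Ioi_deriv_eq h1 (hasCompactSupport_slice_snd h.2 q.1) q.2
  have h2 : ∀ t, deriv (fun t => φ (q.1, t)) t = dτ φ (q.1, t) :=
    fun t => (hasDerivAt_snd_slice h.differentiable q.1 t).deriv
  simp only [h2] at this
  exact this

theorem integrable_slice_snd {φ : ℝ × ℝ → ℝ} (h : Continuous φ) (hc : HasCompactSupport φ)
    (y : ℝ) : Integrable (fun t => φ (y, t)) :=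
  (h.comp (by fun_prop)).integrable_of_hasCompactSupport (hasCompactSupport_slice_snd hc y)

theorem dτ_tail {κ : ℝ × ℝ → ℝ} (h : IsTest₂ κ) (q : ℝ × ℝ) : dτ (tail κ) q = - κ q := by
  have h1 := hasDerivAt_snd_slice ((tail_contDiff h).differentiable (by simp)) q.1 q.2
  refine h1.unique ?_
  have hi := integrable_slice_snd h.continuous h.2 q.1
  have h2 : (fun s => tail κ (q.1, s)) =
      fun s => (∫ t, κ (q.1, t)) - ((∫ t in Iic 0, κ (q.1, t)) + ∫ t in (0 : ℝ)..s, κ (q.1, t)) := by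
    ext s
    rw [← intervalIntegral.integral_Iic_sub_Iic hi.integrableOn hi.integrableOn]
    have := intervalIntegral.integral_Iic_add_Ioi (b := s) hi.integrableOn hi.integrableOn
    simp only [tail]
    linarith
  rw [h2]
  have hcont : Continuous fun t => κ (q.1, t) := h.continuous.comp (by fun_prop)
  have h3 := intervalIntegral.integral_hasDerivAt_right
    (hcont.intervalIntegrable 0 q.2)
    hcont.stronglyMeasurable.stronglyMeasurableAtFilter hcont.continuousAt
  exact (h3.const_add _).const_sub _

theorem dy_tail {κ : ℝ × ℝ → ℝ} (h : IsTest₂ κ) (q : ℝ × ℝ) :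
    dy (tail κ) q = tail (dy κ) q := by
  have h1 := hasDerivAt_fst_slice ((tail_contDiff h).differentiable (by simp)) q.1 q.2
  refine h1.unique ?_
  obtain ⟨A, hA0, hA⟩ := hasCompactSupport_bound h.dy.2
  obtain ⟨C, hC⟩ := h.dy.continuous.bounded_above_of_compact_support h.dy.2
  have := hasDerivAt_integral_of_dominated_loc_of_deriv_le (μ := volume.restrict (Ioi q.2))
    (F := fun y t => κ (y, t)) (F' := fun y t => dy κ (y, t)) (x₀ := q.1) (s := univ)
    (bound := (Icc (-A) A).indicator fun _ => C) Filter.univ_mem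
    (.of_forall fun y => (integrable_slice_snd h.continuous h.2 y).restrict.aestronglyMeasurable)
    (integrable_slice_snd h.continuous h.2 q.1).restrict
    (integrable_slice_snd h.dy.continuous h.dy.2 q.1).restrict.aestronglyMeasurable
    (.of_forall fun t y _ => ?_) ?_
    (.of_forall fun t y _ => hasDerivAt_fst_slice h.differentiable y t)
  · exact this.2
  · by_cases ht : t ∈ Icc (-A) A
    · rw [indicator_of_mem ht]; exact hC _
    · rw [indicator_of_notMem ht]
      have : dy κ (y, t) = 0 := by
        by_contra h0
        exact ht (abs_le.1 (hA _ h0).2)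
      simp [this]
  · refine Integrable.restrict ?_
    rw [integrable_indicator_iff measurableSet_Icc]
    exact integrableOn_const (by simp)

/-- A smooth compactly supported time antiderivative of `κ` in `t > -1`. -/
noncomputable def antideriv (κ : ℝ × ℝ → ℝ) (q : ℝ × ℝ) : ℝ := - (timeCutoff q.2 * tail κ q)

theorem antideriv_isTest {κ : ℝ × ℝ → ℝ} (h : IsTest₂ κ) : IsTest₂ (antideriv κ) := by
  refine ⟨((timeCutoff_contDiff.comp contDiff_snd).mul (tail_contDiff h)).neg, ?_⟩
  obtain ⟨A, hA0, hA⟩ := hasCompactSupport_bound h.2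
  apply hasCompactSupport_of_bound (A := A + 2)
  intro q hq
  have hc : timeCutoff q.2 ≠ 0 := fun h0 => hq (by simp [antideriv, h0])
  have ht : tail κ q ≠ 0 := fun h0 => hq (by simp [antideriv, h0])
  have h2 : -2 < q.2 := by
    by_contra h2
    exact hc (timeCutoff_eq_zero (not_lt.1 h2))
  have : ∃ t, q.2 < t ∧ κ (q.1, t) ≠ 0 := by
    by_contra! hcon
    exact ht (by
      rw [tail]
      exact setIntegral_eq_zero_of_forall_eq_zero hcon)
  obtain ⟨t, htq, hne⟩ := this
  have := hA _ hne
  simp only [abs_le] at this ⊢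
  refine ⟨⟨by linarith, by linarith⟩, ⟨by linarith, by linarith⟩⟩

theorem antideriv_eventuallyEq (κ : ℝ × ℝ → ℝ) {q : ℝ × ℝ} (hq : -1 < q.2) :
    antideriv κ =ᶠ[𝓝 q] fun q => - tail κ q := by
  have : ∀ᶠ z : ℝ × ℝ in 𝓝 q, -1 < z.2 := continuous_snd.continuousAt.eventually (lt_mem_nhds hq)
  filter_upwards [this] with z hz
  rw [antideriv, timeCutoff_eq_one hz.le, one_mul]

/-- The cut-off is locally 1 on this region. Whatever happens below t = -1 is harmless, since the
antiderivative is only paired with quantities that vanish for t ≤ 0. -/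
theorem dτ_antideriv {κ : ℝ × ℝ → ℝ} (h : IsTest₂ κ) {q : ℝ × ℝ} (hq : -1 < q.2) :
    dτ (antideriv κ) q = κ q := by
  have h1 := dτ_tail h q
  simp only [dτ] at h1 ⊢
  rw [(antideriv_eventuallyEq κ hq).fderiv_eq, fderiv_fun_neg, neg_apply, h1, neg_neg]

theorem dy_antideriv {κ : ℝ × ℝ → ℝ} (h : IsTest₂ κ) {q : ℝ × ℝ} (hq : -1 < q.2) :
    dy (antideriv κ) q = - tail (dy κ) q := by
  have h1 := dy_tail h q
  simp only [dy] at h1 ⊢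
  rw [(antideriv_eventuallyEq κ hq).fderiv_eq, fderiv_fun_neg, neg_apply, h1]

/-! ### The mass coordinate and its weak derivatives -/

open scoped Convolution

/-- Bounded densities `r` and momenta `m` on the plane with `∂ₜ r + ∂_y m = 0`, where `r` is
bounded below and `(r, m) = (ρ₀, 0)` for `t ≤ 0`. -/
structure IsMassPair (c M ρ₀ : ℝ) (r m : ℝ × ℝ → ℝ) : Prop where
  c_pos : 0 < c
  measurable_r : Measurable r
  measurable_m : Measurable m
  le_r : ∀ q, c ≤ r q
  r_le : ∀ q, r q ≤ M
  abs_m_le : ∀ q, |m q| ≤ M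
  r_past : ∀ q, q.2 ≤ 0 → r q = ρ₀
  m_past : ∀ q, q.2 ≤ 0 → m q = 0
  mass : ∀ φ, IsTest₂ φ → ∫ q, (r q * dτ φ q + m q * dy φ q) = 0

/-- The mass that has crossed a given place before a given time. -/
noncomputable def crossed (m : ℝ × ℝ → ℝ) (q : ℝ × ℝ) : ℝ := ∫ s in Iio q.2, m (q.1, s)

/-- The Lagrangian mass coordinate. -/
noncomputable def massCoord (ρ₀ : ℝ) (m : ℝ × ℝ → ℝ) (q : ℝ × ℝ) : ℝ := ρ₀ * q.1 - crossed m q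

namespace IsMassPair

variable {c M ρ₀ : ℝ} {r m : ℝ × ℝ → ℝ}

theorem M_nonneg (h : IsMassPair c M ρ₀ r m) : 0 ≤ M := (abs_nonneg _).trans (h.abs_m_le 0)

theorem abs_r_le (h : IsMassPair c M ρ₀ r m) (q : ℝ × ℝ) : |r q| ≤ M := by
  rw [abs_of_nonneg (h.c_pos.le.trans (h.le_r q))]
  exact h.r_le q

theorem crossed_eq (h : IsMassPair c M ρ₀ r m) (q : ℝ × ℝ) :
    crossed m q = ∫ s in Ioo 0 q.2, m (q.1, s) := by
  rw [crossed]
  refine setIntegral_eq_of_subset_of_forall_sdiff_eq_zero measurableSet_Iio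
    (fun s hs => hs.2) fun s hs => ?_
  refine h.m_past _ (not_lt.1 fun h0 => hs.2 ⟨h0, hs.1⟩)

theorem abs_crossed_le (h : IsMassPair c M ρ₀ r m) (q : ℝ × ℝ) : |crossed m q| ≤ M * |q.2| := by
  rw [h.crossed_eq, ← Real.norm_eq_abs]
  have := norm_setIntegral_le_of_norm_le_const (μ := volume) (s := Ioo 0 q.2)
    (f := fun s => m (q.1, s)) (C := M) (by simp) (fun s _ => h.abs_m_le _)
  refine this.trans (mul_le_mul_of_nonneg_left ?_ h.M_nonneg)
  simp only [Measure.real, Real.volume_Ioo, sub_zero]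
  rw [ENNReal.toReal_ofReal']
  exact max_le (le_abs_self _) (abs_nonneg _)

theorem measurable_crossed (h : IsMassPair c M ρ₀ r m) : Measurable (crossed m) := by
  have h1 : crossed m = fun q => ∫ s, {z : (ℝ × ℝ) × ℝ | z.2 < z.1.2}.indicator
      (fun z => m (z.1.1, z.2)) (q, s) := by
    ext q
    rw [crossed, ← integral_indicator measurableSet_Iio]
    rfl
  rw [h1]
  refine (StronglyMeasurable.integral_prod_right (f := fun q s =>
      {z : (ℝ × ℝ) × ℝ | z.2 < z.1.2}.indicator (fun z => m (z.1.1, z.2)) (q, s)) ?_).measurable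
  refine Measurable.stronglyMeasurable ?_
  refine Measurable.indicator (h.measurable_m.comp (by fun_prop)) ?_
  exact measurableSet_lt measurable_snd (by fun_prop)

theorem integrable_crossed_mul (h : IsMassPair c M ρ₀ r m) {κ : ℝ × ℝ → ℝ} (hκ : IsTest₂ κ) :
    Integrable (fun q => crossed m q * κ q) := by
  have hb : Integrable (fun q : ℝ × ℝ => (M * |q.2|) * κ q) :=
    ((by fun_prop : Continuous fun q : ℝ × ℝ => M * |q.2|).mul
      hκ.continuous).integrable_of_hasCompactSupport hκ.2.mul_left
  refine hb.mono (h.measurable_crossed.mul hκ.continuous.measurable).aestronglyMeasurable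
    (.of_forall fun q => ?_)
  rw [norm_mul, norm_mul]
  refine mul_le_mul_of_nonneg_right ?_ (norm_nonneg _)
  exact (h.abs_crossed_le q).trans (le_abs_self _)

/-- The tail is constant in t far below the support of κ, hence not a test function; since `m`
vanishes for t ≤ 0 it may be replaced by one. -/
theorem mul_tail_eq (h : IsMassPair c M ρ₀ r m) (κ : ℝ × ℝ → ℝ) (q : ℝ × ℝ) :
    m q * tail κ q = - (m q * antideriv κ q) := by
  by_cases hq : q.2 ≤ 0
  · simp [h.m_past q hq]
  · rw [(antideriv_eventuallyEq κ (by linarith)).eq_of_nhds]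
    ring

theorem integral_crossed_mul (h : IsMassPair c M ρ₀ r m) {κ : ℝ × ℝ → ℝ} (hκ : IsTest₂ κ) :
    ∫ q, crossed m q * κ q = ∫ q, m q * tail κ q := by
  have hi1 := h.integrable_crossed_mul hκ
  have hi2 : Integrable (fun q => m q * tail κ q) := by
    simp only [h.mul_tail_eq]
    exact (integrable_bdd_mul h.measurable_m h.abs_m_le (antideriv_isTest hκ).continuous
      (antideriv_isTest hκ).2).neg
  rw [Measure.volume_eq_prod] at hi1 hi2 ⊢
  rw [integral_prod _ hi1, integral_prod _ hi2]
  congr 1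
  ext y
  obtain ⟨A, hA0, hA⟩ := hasCompactSupport_bound hκ.2
  have hmy : Measurable fun s => m (y, s) := h.measurable_m.comp (by fun_prop)
  have hκy : Measurable fun s => κ (y, s) := hκ.continuous.measurable.comp (by fun_prop)
  set F : ℝ → ℝ → ℝ := fun t s => {z : ℝ × ℝ | z.2 < z.1}.indicator
    (fun z => m (y, z.2) * κ (y, z.1)) (t, s) with hF
  -- Fubini on the region s < t. Although s ranges over a half-line, the integrand lives on 0 < s <
  -- t ≤ A: `m` vanishes in the past and κ vanishes beyond A.
  have hFi : Integrable (Function.uncurry F) := by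
    have hb : Integrable (fun z : ℝ × ℝ => κ (y, z.1) * (Icc 0 A).indicator (fun _ => M) z.2)
        (volume.prod volume) :=
      (integrable_slice_snd hκ.continuous hκ.2 y).mul_prod
        ((integrable_indicator_iff measurableSet_Icc).2 (integrableOn_const (by simp)))
    refine hb.mono ?_ (.of_forall fun z => ?_)
    · refine Measurable.aestronglyMeasurable ?_
      refine Measurable.indicator ?_ (measurableSet_lt measurable_snd measurable_fst)
      exact (hmy.comp measurable_snd).mul (hκy.comp measurable_fst)
    · simp only [Function.uncurry, hF, Prod.mk.eta]
      by_cases hz : z.2 < z.1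
      · rw [indicator_of_mem (by exact hz), norm_mul, norm_mul]
        by_cases hk : κ (y, z.1) = 0
        · simp [hk]
        have h2 := (abs_le.1 (hA _ hk).2).2
        dsimp only at h2
        by_cases h0 : z.2 ≤ 0
        · rw [h.m_past (y, z.2) h0]; simp; positivity
        · rw [indicator_of_mem (show z.2 ∈ Icc 0 A from ⟨by linarith, by linarith⟩), mul_comm]
          refine mul_le_mul_of_nonneg_left ?_ (norm_nonneg _)
          exact (h.abs_m_le _).trans (le_abs_self _)
      · rw [indicator_of_notMem (by exact hz), norm_zero]
        exact norm_nonneg _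
  have hL : ∀ t, crossed m (y, t) * κ (y, t) = ∫ s, F t s := by
    intro t
    rw [crossed, ← integral_indicator measurableSet_Iio, ← integral_mul_const]
    congr 1
    ext s
    by_cases hs : s < t <;> simp [hF, hs]
  have hR : ∀ s, m (y, s) * tail κ (y, s) = ∫ t, F t s := by
    intro s
    rw [tail, ← integral_indicator measurableSet_Ioi, ← integral_const_mul]
    congr 1
    ext t
    by_cases hs : s < t <;> simp [hF, hs]
  simp only [hL, hR]
  exact integral_integral_swap hFi

theorem measurable_massCoord (h : IsMassPair c M ρ₀ r m) : Measurable (massCoord ρ₀ m) :=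
  (measurable_fst.const_mul ρ₀).sub h.measurable_crossed

theorem abs_massCoord_le (h : IsMassPair c M ρ₀ r m) (q : ℝ × ℝ) :
    |massCoord ρ₀ m q| ≤ |ρ₀| * |q.1| + M * |q.2| := by
  refine (abs_sub _ _).trans ?_
  rw [abs_mul]
  exact add_le_add le_rfl (h.abs_crossed_le q)

theorem locallyIntegrable_massCoord (h : IsMassPair c M ρ₀ r m) :
    LocallyIntegrable (massCoord ρ₀ m) := by
  have hb : LocallyIntegrable (fun q : ℝ × ℝ => |ρ₀| * |q.1| + M * |q.2|) :=
    (by fun_prop : Continuous fun q : ℝ × ℝ => |ρ₀| * |q.1| + M * |q.2|).locallyIntegrable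
  refine hb.mono h.measurable_massCoord.aestronglyMeasurable (.of_forall fun q => ?_)
  exact (h.abs_massCoord_le q).trans (le_abs_self _)

theorem integrable_fst_mul {κ : ℝ × ℝ → ℝ} (hκ : IsTest₂ κ) (a : ℝ) :
    Integrable (fun q : ℝ × ℝ => a * q.1 * κ q) :=
  ((by fun_prop : Continuous fun q : ℝ × ℝ => a * q.1).mul
    hκ.continuous).integrable_of_hasCompactSupport hκ.2.mul_left

theorem integral_fst_mul_dτ {φ : ℝ × ℝ → ℝ} (hφ : IsTest₂ φ) (a : ℝ) :
    ∫ q : ℝ × ℝ, a * q.1 * dτ φ q = 0 := by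
  have hi := integrable_fst_mul hφ.dτ a
  rw [Measure.volume_eq_prod] at hi ⊢
  rw [integral_prod _ hi]
  refine integral_eq_zero_of_ae (.of_forall fun y => ?_)
  dsimp only [Pi.zero_apply]
  rw [integral_const_mul, integral_eq_zero_of_hasDerivAt_of_integrable
    (f := fun t => φ (y, t)) (fun t => hasDerivAt_snd_slice hφ.differentiable y t), mul_zero]
  · exact integrable_slice_snd hφ.dτ.continuous hφ.dτ.2 y
  · exact integrable_slice_snd hφ.continuous hφ.2 y

theorem integral_fst_mul_dy {φ : ℝ × ℝ → ℝ} (hφ : IsTest₂ φ) (a : ℝ) :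
    ∫ q : ℝ × ℝ, a * q.1 * dy φ q = - ∫ q, a * φ q := by
  have hi := integrable_fst_mul hφ.dy a
  have hi2 : Integrable (fun q => a * φ q) :=
    (hφ.continuous.integrable_of_hasCompactSupport hφ.2).const_mul a
  have hs : Integrable (fun q : ℝ × ℝ => a * q.1 * dy φ q + a * φ q) := hi.add hi2
  -- The integrand is the y-derivative of a y φ(y, t).
  have key : ∫ q : ℝ × ℝ, (a * q.1 * dy φ q + a * φ q) = 0 := by
    rw [Measure.volume_eq_prod] at hs ⊢
    rw [integral_prod_symm _ hs]
    refine integral_eq_zero_of_ae (.of_forall fun t => ?_)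
    refine integral_eq_zero_of_hasDerivAt_of_integrable
      (f := fun y => a * y * φ (y, t)) (fun y => ?_) ?_ ?_
    · have h1 := ((hasDerivAt_id y).const_mul a).mul (hasDerivAt_fst_slice hφ.differentiable y t)
      refine h1.congr_deriv ?_
      simp only [id]
      ring
    · exact (((by fun_prop : Continuous fun y : ℝ => a * y).mul
        (hφ.dy.continuous.comp (by fun_prop))).add ((hφ.continuous.comp
          (by fun_prop)).const_mul a)).integrable_of_hasCompactSupport
        ((hasCompactSupport_slice_fst hφ.dy.2 t).mul_left.add
          (hasCompactSupport_slice_fst hφ.2 t).mul_left)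
    · exact ((by fun_prop : Continuous fun y : ℝ => a * y).mul
        (hφ.continuous.comp (by fun_prop))).integrable_of_hasCompactSupport
        (hasCompactSupport_slice_fst hφ.2 t).mul_left
  rw [integral_add hi hi2] at key
  linarith

/-- The weak time derivative of the mass coordinate is `-m`. -/
theorem integral_massCoord_mul_dτ (h : IsMassPair c M ρ₀ r m) {φ : ℝ × ℝ → ℝ} (hφ : IsTest₂ φ) :
    ∫ q, massCoord ρ₀ m q * dτ φ q = ∫ q, m q * φ q := by
  simp only [massCoord, sub_mul]
  rw [integral_sub (integrable_fst_mul hφ.dτ ρ₀) (h.integrable_crossed_mul hφ.dτ),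
    integral_fst_mul_dτ hφ, h.integral_crossed_mul hφ.dτ, zero_sub, ← integral_neg]
  congr 1
  ext q
  rw [tail_dτ hφ]
  ring

/-- The weak space derivative of the mass coordinate is `r`. -/
theorem integral_massCoord_mul_dy (h : IsMassPair c M ρ₀ r m) {φ : ℝ × ℝ → ℝ} (hφ : IsTest₂ φ) :
    ∫ q, massCoord ρ₀ m q * dy φ q = - ∫ q, r q * φ q := by
  simp only [massCoord, sub_mul]
  rw [integral_sub (integrable_fst_mul hφ.dy ρ₀) (h.integrable_crossed_mul hφ.dy),
    integral_fst_mul_dy hφ, h.integral_crossed_mul hφ.dy]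
  -- The time antiderivative of φ is put into the mass equation: its time derivative returns the
  -- pairing with `r`, its space derivative the pairing with `crossed m`.
  have hΘ := antideriv_isTest hφ
  have hm := h.mass _ hΘ
  have hi1 : Integrable (fun q => r q * dτ (antideriv φ) q) :=
    integrable_bdd_mul h.measurable_r h.abs_r_le hΘ.dτ.continuous hΘ.dτ.2
  have hi2 : Integrable (fun q => m q * dy (antideriv φ) q) :=
    integrable_bdd_mul h.measurable_m h.abs_m_le hΘ.dy.continuous hΘ.dy.2
  have hi3 : Integrable (fun q => r q * φ q) :=
    integrable_bdd_mul h.measurable_r h.abs_r_le hφ.continuous hφ.2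
  have hi4 : Integrable (fun q => ρ₀ * φ q) :=
    (hφ.continuous.integrable_of_hasCompactSupport hφ.2).const_mul ρ₀
  have hi5 : Integrable (fun q => ρ₀ * dτ (antideriv φ) q) :=
    (hΘ.dτ.continuous.integrable_of_hasCompactSupport hΘ.dτ.2).const_mul ρ₀
  rw [integral_add hi1 hi2] at hm
  have e1 : ∫ q, m q * dy (antideriv φ) q = - ∫ q, m q * tail (dy φ) q := by
    rw [← integral_neg]
    congr 1
    ext q
    by_cases hq : q.2 ≤ 0
    · simp [h.m_past q hq]
    · rw [dy_antideriv hφ (by linarith)]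
      ring
  -- Subtracting ρ₀ removes the region t ≤ 0, where the antiderivative need not have derivative φ.
  have e2 : ∫ q, (r q * dτ (antideriv φ) q - ρ₀ * dτ (antideriv φ) q)
      = ∫ q, (r q * φ q - ρ₀ * φ q) := by
    congr 1
    ext q
    by_cases hq : q.2 ≤ 0
    · rw [h.r_past q hq]; ring
    · rw [dτ_antideriv hφ (by linarith)]
  have e3 : ∫ q, ρ₀ * dτ (antideriv φ) q = 0 := by
    have h1 := integral_add_compl measurableSet_upper₂ hi5
    have h2 := integral_upper₂_dτ hΘ (g := fun _ => ρ₀) measurable_const (fun _ => le_rfl)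
    have h3 := integral_lower₂_dτ hΘ (g := fun _ => ρ₀) measurable_const (fun _ => le_rfl)
    linarith
  rw [integral_sub hi1 hi5, integral_sub hi3 hi4, e3] at e2
  linarith

end IsMassPair

/-! ### Mollification -/

/-- A sequence of bump functions shrinking to the origin. -/
noncomputable def bump (n : ℕ) : ContDiffBump (0 : ℝ × ℝ) where
  rIn := 1 / ((n : ℝ) + 1)
  rOut := 2 * (1 / ((n : ℝ) + 1))
  rIn_pos := by positivity
  rIn_lt_rOut := by
    have : 0 < 1 / ((n : ℝ) + 1) := by positivity
    linarith

/-- The normalized mollifier. -/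
noncomputable def mollifier (n : ℕ) : ℝ × ℝ → ℝ := (bump n).normed volume

/-- Mollification of a function on the plane. -/
noncomputable def mollify (n : ℕ) (g : ℝ × ℝ → ℝ) : ℝ × ℝ → ℝ :=
  mollifier n ⋆[ContinuousLinearMap.lsmul ℝ ℝ, volume] g

theorem bump_rOut_tendsto : Tendsto (fun n => (bump n).rOut) atTop (𝓝 0) := by
  have := (tendsto_one_div_add_atTop_nhds_zero_nat (𝕜 := ℝ)).const_mul 2
  simpa [bump] using this

theorem mollifier_isTest (n : ℕ) : IsTest₂ (mollifier n) :=
  ⟨(bump n).contDiff_normed, (bump n).hasCompactSupport_normed⟩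

theorem mollify_apply (n : ℕ) (g : ℝ × ℝ → ℝ) (x : ℝ × ℝ) :
    mollify n g x = ∫ q, g q * mollifier n (x - q) := by
  rw [mollify, ← convolution_flip, convolution_def]
  congr 1
  ext q
  simp [mul_comm]

theorem mollify_contDiff (n : ℕ) {g : ℝ × ℝ → ℝ} (hg : LocallyIntegrable g) :
    ContDiff ℝ ∞ (mollify n g) :=
  (mollifier_isTest n).2.contDiff_convolution_left _ (mollifier_isTest n).1 hg

theorem mollify_tendsto {g : ℝ × ℝ → ℝ} (hg : LocallyIntegrable g) :
    ∀ᵐ x, Tendsto (fun n => mollify n g x) atTop (𝓝 (g x)) :=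
  ContDiffBump.ae_convolution_tendsto_right_of_locallyIntegrable bump_rOut_tendsto
    (K := 2) (.of_forall fun _ => le_rfl) hg

theorem mollify_tendsto_of_continuous {g : ℝ × ℝ → ℝ} (hg : Continuous g) (x : ℝ × ℝ) :
    Tendsto (fun n => mollify n g x) atTop (𝓝 (g x)) :=
  ContDiffBump.convolution_tendsto_right_of_continuous bump_rOut_tendsto hg x

theorem mollifier_reflect_isTest (n : ℕ) (x : ℝ × ℝ) : IsTest₂ fun q => mollifier n (x - q) :=
  ⟨(mollifier_isTest n).1.comp (contDiff_const.sub contDiff_id),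
    (mollifier_isTest n).2.comp_homeomorph (Homeomorph.subLeft x)⟩

theorem fderiv_mollifier_reflect (n : ℕ) (x q e : ℝ × ℝ) :
    fderiv ℝ (fun q => mollifier n (x - q)) q e = - fderiv ℝ (mollifier n) (x - q) e := by
  have h1 : HasFDerivAt (fun q : ℝ × ℝ => x - q) (-ContinuousLinearMap.id ℝ (ℝ × ℝ)) q :=
    (hasFDerivAt_id q).const_sub x
  have h2 := ((mollifier_isTest n).differentiable (x - q)).hasFDerivAt.comp q h1
  have h3 := h2.fderiv
  simp only [Function.comp_def] at h3
  rw [h3]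
  simp

/-- Putting the derivative on the reflected kernel in the integration variable, at the cost of a
sign, gives a pairing with the derivative of a test function, ready for weak derivatives. -/
theorem fderiv_mollify (n : ℕ) {g : ℝ × ℝ → ℝ} (hg : LocallyIntegrable g) (x e : ℝ × ℝ) :
    fderiv ℝ (mollify n g) x e =
      - ∫ q, g q * fderiv ℝ (fun q => mollifier n (x - q)) q e := by
  have hη := mollifier_isTest n
  have h0 : mollify n g = g ⋆[(ContinuousLinearMap.lsmul ℝ ℝ).flip, volume] mollifier n := by
    rw [mollify, ← convolution_flip]
  have h1 := hη.2.hasFDerivAt_convolution_right (ContinuousLinearMap.lsmul ℝ ℝ).flip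
    (μ := volume) hg (hη.1.of_le (by simp)) x
  rw [h0, h1.fderiv, convolution_precompR_apply _ hg (hη.2.fderiv ℝ)
    (hη.1.continuous_fderiv (by simp)), convolution_def, ← integral_neg]
  congr 1
  ext q
  rw [fderiv_mollifier_reflect]
  simp only [ContinuousLinearMap.flip_apply, ContinuousLinearMap.lsmul_apply, smul_eq_mul]
  ring

theorem integral_mollifier_reflect (n : ℕ) (x : ℝ × ℝ) : ∫ q, mollifier n (x - q) = 1 := by
  rw [integral_sub_left_eq_self (mollifier n) volume x]
  exact (bump n).integral_normed

theorem mollifier_nonneg (n : ℕ) (x : ℝ × ℝ) : 0 ≤ mollifier n x := (bump n).nonneg_normed x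

theorem mollify_le (n : ℕ) {g : ℝ × ℝ → ℝ} {M C : ℝ} (hg : Measurable g) (hC : ∀ q, |g q| ≤ C)
    (hM : ∀ q, g q ≤ M) (x : ℝ × ℝ) : mollify n g x ≤ M := by
  have ht := mollifier_reflect_isTest n x
  have h1 : ∫ q, M * mollifier n (x - q) = M := by
    rw [integral_const_mul, integral_mollifier_reflect, mul_one]
  rw [mollify_apply, ← h1]
  exact integral_mono (integrable_bdd_mul hg hC ht.continuous ht.2)
    ((ht.continuous.integrable_of_hasCompactSupport ht.2).const_mul M)
    fun q => mul_le_mul_of_nonneg_right (hM q) (mollifier_nonneg n _)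

theorem le_mollify (n : ℕ) {g : ℝ × ℝ → ℝ} {c C : ℝ} (hg : Measurable g) (hC : ∀ q, |g q| ≤ C)
    (hc : ∀ q, c ≤ g q) (x : ℝ × ℝ) : c ≤ mollify n g x := by
  have ht := mollifier_reflect_isTest n x
  have h1 : ∫ q, c * mollifier n (x - q) = c := by
    rw [integral_const_mul, integral_mollifier_reflect, mul_one]
  rw [mollify_apply]
  nth_rw 1 [← h1]
  exact integral_mono ((ht.continuous.integrable_of_hasCompactSupport ht.2).const_mul c)
    (integrable_bdd_mul hg hC ht.continuous ht.2)
    fun q => mul_le_mul_of_nonneg_right (hc q) (mollifier_nonneg n _)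

theorem locallyIntegrable_of_bdd {g : ℝ × ℝ → ℝ} {C : ℝ} (hg : Measurable g)
    (hC : ∀ q, |g q| ≤ C) : LocallyIntegrable g :=
  (locallyIntegrable_const C).mono hg.aestronglyMeasurable
    (.of_forall fun q => (hC q).trans (le_abs_self _))

namespace IsMassPair

variable {c M ρ₀ : ℝ} {r m : ℝ × ℝ → ℝ}

theorem dy_mollify (h : IsMassPair c M ρ₀ r m) (n : ℕ) (x : ℝ × ℝ) :
    dy (mollify n (massCoord ρ₀ m)) x = mollify n r x := by
  have := h.integral_massCoord_mul_dy (mollifier_reflect_isTest n x)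
  rw [dy, fderiv_mollify n h.locallyIntegrable_massCoord, mollify_apply]
  simp only [dy] at this
  linarith

theorem dτ_mollify (h : IsMassPair c M ρ₀ r m) (n : ℕ) (x : ℝ × ℝ) :
    dτ (mollify n (massCoord ρ₀ m)) x = - mollify n m x := by
  have := h.integral_massCoord_mul_dτ (mollifier_reflect_isTest n x)
  rw [dτ, fderiv_mollify n h.locallyIntegrable_massCoord, mollify_apply]
  simp only [dτ] at this
  linarith

end IsMassPair

/-! ### Passage to the limit, and functions strictly increasing in space -/

/-- A bounded limit of functions of vanishing integral, all supported in one box, has vanishing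
integral. -/
theorem integral_eq_zero_of_tendsto {F : ℕ → ℝ × ℝ → ℝ} {f : ℝ × ℝ → ℝ} {A C : ℝ}
    (hF : ∀ n, Measurable (F n)) (hC : ∀ n q, |F n q| ≤ C)
    (hA : ∀ n q, F n q ≠ 0 → |q.1| ≤ A ∧ |q.2| ≤ A)
    (hlim : ∀ᵐ q, Tendsto (fun n => F n q) atTop (𝓝 (f q))) (h0 : ∀ n, ∫ q, F n q = 0) :
    ∫ q, f q = 0 := by
  have hbox : MeasurableSet (Icc (-A) A ×ˢ Icc (-A) A) := measurableSet_Icc.prod measurableSet_Icc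
  have := tendsto_integral_of_dominated_convergence (μ := volume) (F := F) (f := f)
    ((Icc (-A) A ×ˢ Icc (-A) A).indicator fun _ => C)
    (fun n => (hF n).aestronglyMeasurable) ?_ (fun n => .of_forall fun q => ?_) hlim
  · simp only [h0] at this
    exact tendsto_nhds_unique this tendsto_const_nhds
  · rw [integrable_indicator_iff hbox]
    exact integrableOn_const ((isCompact_Icc.prod isCompact_Icc).measure_lt_top.ne)
  · by_cases hq : F n q = 0
    · rw [hq, norm_zero]
      exact indicator_nonneg (fun _ _ => (abs_nonneg _).trans (hC 0 0)) q
    · have := hA n q hq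
      rw [abs_le, abs_le] at this
      rw [indicator_of_mem (show q ∈ Icc (-A) A ×ˢ Icc (-A) A from this)]
      exact hC n q

/-- The slopes of `ψ` lie in `[c, M]` in space and in `[-M, M]` in time. -/
structure HasSlopes (c M : ℝ) (ψ : ℝ × ℝ → ℝ) : Prop where
  lower : ∀ y₁ y₂ t, y₁ ≤ y₂ → c * (y₂ - y₁) ≤ ψ (y₂, t) - ψ (y₁, t)
  upper : ∀ y₁ y₂ t, y₁ ≤ y₂ → ψ (y₂, t) - ψ (y₁, t) ≤ M * (y₂ - y₁)
  time : ∀ y t₁ t₂, |ψ (y, t₁) - ψ (y, t₂)| ≤ M * |t₁ - t₂|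

namespace HasSlopes

variable {c M : ℝ} {ψ : ℝ × ℝ → ℝ}

theorem abs_lower (h : HasSlopes c M ψ) (y₁ y₂ t : ℝ) :
    c * |y₁ - y₂| ≤ |ψ (y₁, t) - ψ (y₂, t)| := by
  rcases le_total y₁ y₂ with h1 | h1
  · rw [abs_sub_comm, abs_of_nonneg (sub_nonneg.2 h1), abs_sub_comm]
    exact (h.lower _ _ t h1).trans (le_abs_self _)
  · rw [abs_of_nonneg (sub_nonneg.2 h1)]
    exact (h.lower _ _ t h1).trans (le_abs_self _)

theorem abs_upper (h : HasSlopes c M ψ) (hc : 0 < c) (y₁ y₂ t : ℝ) :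
    |ψ (y₁, t) - ψ (y₂, t)| ≤ M * |y₁ - y₂| := by
  rcases le_total y₁ y₂ with h1 | h1
  · rw [abs_sub_comm, abs_sub_comm y₁, abs_of_nonneg (sub_nonneg.2 h1), abs_of_nonneg]
    · exact h.upper _ _ t h1
    · exact (mul_nonneg hc.le (sub_nonneg.2 h1)).trans (h.lower _ _ t h1)
  · rw [abs_of_nonneg (sub_nonneg.2 h1), abs_of_nonneg]
    · exact h.upper _ _ t h1
    · exact (mul_nonneg hc.le (sub_nonneg.2 h1)).trans (h.lower _ _ t h1)

theorem nonneg (h : HasSlopes c M ψ) : 0 ≤ M := by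
  have := h.time 0 1 0
  simp only [sub_zero, abs_one, mul_one] at this
  exact (abs_nonneg _).trans this

theorem lipschitz (h : HasSlopes c M ψ) (hc : 0 < c) (q q' : ℝ × ℝ) :
    |ψ q - ψ q'| ≤ 2 * M * dist q q' := by
  have h1 := h.abs_upper hc q.1 q'.1 q.2
  have h2 := h.time q'.1 q.2 q'.2
  have h3 : |q.1 - q'.1| ≤ dist q q' := le_max_left (dist q.1 q'.1) (dist q.2 q'.2)
  have h4 : |q.2 - q'.2| ≤ dist q q' := le_max_right (dist q.1 q'.1) (dist q.2 q'.2)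
  have h5 := mul_le_mul_of_nonneg_left h3 h.nonneg
  have h6 := mul_le_mul_of_nonneg_left h4 h.nonneg
  have h7 := abs_sub_le (ψ (q.1, q.2)) (ψ (q'.1, q.2)) (ψ (q'.1, q'.2))
  simp only [Prod.mk.eta] at h1 h2 h7
  linarith

theorem continuous (h : HasSlopes c M ψ) (hc : 0 < c) : Continuous ψ :=
  (LipschitzWith.of_dist_le_mul (K := ⟨2 * M, mul_nonneg zero_le_two h.nonneg⟩)
    fun q q' => h.lipschitz hc q q').continuous

/-- Properness of (y, t) ↦ (ψ(y, t), t), with a bound depending on ψ only through c, M and its value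
at the origin. It confines the supports of G(ψₙ, t) to one box for a whole sequence ψₙ. -/
theorem abs_fst_le (h : HasSlopes c M ψ) (hc : 0 < c) {A B : ℝ} (hB : |ψ (0, 0)| ≤ B)
    {q : ℝ × ℝ} (h1 : |ψ q| ≤ A) (h2 : |q.2| ≤ A) : |q.1| ≤ (A + B + M * A) / c := by
  rw [le_div_iff₀ hc]
  have e1 := h.abs_lower q.1 0 q.2
  have e2 := h.time 0 q.2 0
  have e3 := mul_le_mul_of_nonneg_left h2 h.nonneg
  simp only [sub_zero, Prod.mk.eta] at e1 e2
  have e4 := abs_sub (ψ q) (ψ (0, q.2))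
  have e5 := abs_add_le (ψ (0, q.2) - ψ (0, 0)) (ψ (0, 0))
  rw [sub_add_cancel] at e5
  linarith

/-- Difference quotients, unlike derivatives, survive pointwise limits; this is why the bounds are
stated through them. -/
theorem of_tendsto {f : ℕ → ℝ × ℝ → ℝ} (h : ∀ n, HasSlopes c M (f n))
    (hlim : ∀ q, Tendsto (fun n => f n q) atTop (𝓝 (ψ q))) : HasSlopes c M ψ where
  lower _ _ t hy := ge_of_tendsto' ((hlim _).sub (hlim _)) fun n => (h n).lower _ _ t hy
  upper _ _ t hy := le_of_tendsto' ((hlim _).sub (hlim _)) fun n => (h n).upper _ _ t hy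
  time y t₁ t₂ := le_of_tendsto' ((hlim _).sub (hlim _)).abs fun n => (h n).time y t₁ t₂

theorem of_deriv (hψ : Differentiable ℝ ψ) (h1 : ∀ q, c ≤ dy ψ q) (h2 : ∀ q, dy ψ q ≤ M)
    (h3 : ∀ q, |dτ ψ q| ≤ M) : HasSlopes c M ψ where
  lower y₁ y₂ t hy := by
    have hd := fun y => hasDerivAt_fst_slice hψ y t
    exact mul_sub_le_image_sub_of_le_deriv (f := fun y => ψ (y, t))
      (fun y => (hd y).differentiableAt) (fun y => by rw [(hd y).deriv]; exact h1 _) hy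
  upper y₁ y₂ t hy := by
    have hd := fun y => hasDerivAt_fst_slice hψ y t
    exact image_sub_le_mul_sub_of_deriv_le (f := fun y => ψ (y, t))
      (fun y => (hd y).differentiableAt) (fun y => by rw [(hd y).deriv]; exact h2 _) hy
  time y t₁ t₂ := by
    have hd := fun t => hasDerivAt_snd_slice hψ y t
    exact convex_univ.norm_image_sub_le_of_norm_hasDerivWithin_le (f := fun t => ψ (y, t))
      (fun t _ => (hd t).hasDerivWithinAt) (fun t _ => h3 _) (mem_univ t₂) (mem_univ t₁)

/-- Pairing with time yields a homeomorphism; this is its inverse. -/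
theorem exists_inverse (h : HasSlopes c M ψ) (hc : 0 < c) :
    ∃ Y : ℝ × ℝ → ℝ, Continuous Y ∧ (∀ z, ψ (Y z, z.2) = z.1) ∧ ∀ q, Y (ψ q, q.2) = q.1 := by
  have hsurj : ∀ z : ℝ × ℝ, ∃ y, ψ (y, z.2) = z.1 := by
    intro z
    have hcont : Continuous fun y => ψ (y, z.2) := (h.continuous hc).comp (by fun_prop)
    -- Slope at least c means that moving by |z.1 - ψ(0, z.2)| / c changes ψ by at least the
    -- required amount.
    have h1 : ∃ y, ψ (y, z.2) ≤ z.1 := by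
      refine ⟨- (|z.1 - ψ (0, z.2)| / c), ?_⟩
      have e0 : 0 ≤ |z.1 - ψ (0, z.2)| / c := by positivity
      have e := h.lower (- (|z.1 - ψ (0, z.2)| / c)) 0 z.2 (by linarith)
      rw [show c * (0 - -(|z.1 - ψ (0, z.2)| / c)) = |z.1 - ψ (0, z.2)| by field_simp; ring] at e
      have := neg_abs_le (z.1 - ψ (0, z.2))
      linarith
    have h2 : ∃ y, z.1 ≤ ψ (y, z.2) := by
      refine ⟨|z.1 - ψ (0, z.2)| / c, ?_⟩
      have e0 : 0 ≤ |z.1 - ψ (0, z.2)| / c := by positivity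
      have e := h.lower 0 (|z.1 - ψ (0, z.2)| / c) z.2 e0
      rw [show c * (|z.1 - ψ (0, z.2)| / c - 0) = |z.1 - ψ (0, z.2)| by field_simp; ring] at e
      have := le_abs_self (z.1 - ψ (0, z.2))
      linarith
    exact mem_range_of_exists_le_of_exists_ge hcont h1 h2
  choose Y hY using hsurj
  -- A change of Y is at most 1/c times the change of ψ at fixed time, which comes from the change
  -- of target plus the drift M |t - t'|.
  have hlip : ∀ z z', |Y z - Y z'| ≤ (1 + M) / c * dist z z' := by
    intro z z'
    rw [div_mul_eq_mul_div, le_div_iff₀ hc]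
    have e1 := h.abs_lower (Y z) (Y z') z.2
    have e2 := h.time (Y z') z.2 z'.2
    have e3 := abs_sub_le (ψ (Y z, z.2)) (ψ (Y z', z'.2)) (ψ (Y z', z.2))
    rw [hY, hY] at e3
    rw [hY] at e1 e2
    rw [abs_sub_comm z'.1] at e3
    have h3 : |z.1 - z'.1| ≤ dist z z' := le_max_left (dist z.1 z'.1) (dist z.2 z'.2)
    have h4 : |z.2 - z'.2| ≤ dist z z' := le_max_right (dist z.1 z'.1) (dist z.2 z'.2)
    have h6 := mul_le_mul_of_nonneg_left h4 h.nonneg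
    linarith
  refine ⟨Y, ?_, hY, fun q => ?_⟩
  · exact (LipschitzWith.of_dist_le_mul
      (K := ⟨(1 + M) / c, div_nonneg (add_nonneg zero_le_one h.nonneg) hc.le⟩)
      fun q q' => hlip q q').continuous
  · have e1 := h.abs_lower (Y (ψ q, q.2)) q.1 q.2
    rw [hY (ψ q, q.2)] at e1
    simp only [Prod.mk.eta, sub_self, abs_zero] at e1
    have : |Y (ψ q, q.2) - q.1| ≤ 0 := by
      by_contra! hlt
      exact absurd e1 (not_le.2 (mul_pos hc hlt))
    exact sub_eq_zero.1 (abs_nonpos_iff.1 this)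

end HasSlopes

/-- Uniformly Lipschitz functions converging almost everywhere converge everywhere. -/
theorem exists_tendsto_of_lipschitz {f : ℕ → ℝ × ℝ → ℝ} {g : ℝ × ℝ → ℝ} {L : ℝ}
    (hf : ∀ n q q', |f n q - f n q'| ≤ L * dist q q')
    (hae : ∀ᵐ q, Tendsto (fun n => f n q) atTop (𝓝 (g q))) (q : ℝ × ℝ) :
    ∃ l, Tendsto (fun n => f n q) atTop (𝓝 l) := by
  apply cauchySeq_tendsto_of_complete
  rw [Metric.cauchySeq_iff']
  intro e he
  have hd : Dense {q | Tendsto (fun n => f n q) atTop (𝓝 (g q))} := Measure.dense_of_ae hae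
  have hL : 0 < |L| + 1 := by positivity
  -- Points of convergence have full measure, so they are dense; the uniform Lipschitz bound carries
  -- the Cauchy property from a nearby one.
  obtain ⟨q', hq', hdist⟩ := hd.exists_dist_lt q (ε := e / 3 / (|L| + 1)) (by positivity)
  obtain ⟨N, hN⟩ := Metric.cauchySeq_iff'.1 hq'.cauchySeq (e / 3) (by positivity)
  refine ⟨N, fun n hn => ?_⟩
  have h1 : ∀ k, |f k q - f k q'| ≤ e / 3 := by
    intro k
    rw [lt_div_iff₀ hL] at hdist
    have := hf k q q'
    have h2 : L * dist q q' ≤ (|L| + 1) * dist q q' :=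
      mul_le_mul_of_nonneg_right ((le_abs_self L).trans (by linarith)) dist_nonneg
    linarith
  have h2 := hN n hn
  rw [Real.dist_eq] at h2 ⊢
  have h3 := h1 n
  have h4 := h1 N
  rw [abs_lt] at h2 ⊢
  rw [abs_le] at h3 h4
  constructor <;> linarith

/-! ### Transport in mass coordinates -/

/-- `w` is transported by the flow of `(r, m)`. -/
def IsTransported (r m w : ℝ × ℝ → ℝ) : Prop :=
  ∀ φ, IsTest₂ φ → ∫ q, w q * (r q * dτ φ q + m q * dy φ q) = 0

theorem fderiv_comp_pair {G ψ : ℝ × ℝ → ℝ} (hG : Differentiable ℝ G) (hψ : Differentiable ℝ ψ)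
    (q e : ℝ × ℝ) : fderiv ℝ (fun q => G (ψ q, q.2)) q e =
      fderiv ℝ ψ q e * dy G (ψ q, q.2) + e.2 * dτ G (ψ q, q.2) := by
  have h1 : HasFDerivAt (fun q : ℝ × ℝ => (ψ q, q.2))
      ((fderiv ℝ ψ q).prod (ContinuousLinearMap.snd ℝ ℝ ℝ)) q :=
    (hψ q).hasFDerivAt.prodMk hasFDerivAt_snd
  have h2 := ((hG (ψ q, q.2)).hasFDerivAt.comp q h1).fderiv
  simp only [Function.comp_def] at h2
  rw [h2]
  simp only [ContinuousLinearMap.comp_apply, ContinuousLinearMap.prod_apply,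
    ContinuousLinearMap.coe_snd', dy, dτ]
  have h3 : (fderiv ℝ ψ q e, e.2) =
      fderiv ℝ ψ q e • ((1 : ℝ), (0 : ℝ)) + e.2 • ((0 : ℝ), (1 : ℝ)) := by
    simp
  rw [h3, map_add, map_smul, map_smul, smul_eq_mul, smul_eq_mul]

namespace IsMassPair

variable {c M ρ₀ : ℝ} {r m : ℝ × ℝ → ℝ}

theorem hasSlopes_mollify (h : IsMassPair c M ρ₀ r m) (n : ℕ) :
    HasSlopes c M (mollify n (massCoord ρ₀ m)) := by
  refine HasSlopes.of_deriv
    ((mollify_contDiff n h.locallyIntegrable_massCoord).differentiable (by simp)) ?_ ?_ ?_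
  · intro q
    rw [h.dy_mollify]
    exact le_mollify n h.measurable_r h.abs_r_le h.le_r q
  · intro q
    rw [h.dy_mollify]
    exact mollify_le n h.measurable_r h.abs_r_le h.r_le q
  · intro q
    rw [h.dτ_mollify, abs_neg, abs_le]
    exact ⟨le_mollify n h.measurable_m h.abs_m_le (fun q => (abs_le.1 (h.abs_m_le q)).1) q,
      mollify_le n h.measurable_m h.abs_m_le (fun q => (abs_le.1 (h.abs_m_le q)).2) q⟩

/-- `massCoord` is only measurable as defined. Its mollifications have uniform slope bounds and
converge almost everywhere, hence everywhere, to a continuous version with the same bounds. -/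
theorem exists_continuous_massCoord (h : IsMassPair c M ρ₀ r m) :
    ∃ ψ, (∀ q, Tendsto (fun n => mollify n (massCoord ρ₀ m) q) atTop (𝓝 (ψ q))) ∧
      (∀ᵐ q, ψ q = massCoord ρ₀ m q) ∧ HasSlopes c M ψ := by
  have hae := mollify_tendsto h.locallyIntegrable_massCoord
  choose ψ hψ using exists_tendsto_of_lipschitz
    (fun n => (h.hasSlopes_mollify n).lipschitz h.c_pos) hae
  refine ⟨ψ, hψ, ?_, HasSlopes.of_tendsto h.hasSlopes_mollify hψ⟩
  filter_upwards [hae] with q hq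
  exact tendsto_nhds_unique (hψ q) hq

/-- In mass coordinates, transported quantities have vanishing time derivative. -/
theorem integral_transported (h : IsMassPair c M ρ₀ r m) {w ψ : ℝ × ℝ → ℝ} {B : ℝ}
    (hψ : ∀ q, Tendsto (fun n => mollify n (massCoord ρ₀ m) q) atTop (𝓝 (ψ q)))
    (hw : Measurable w) (hB : ∀ q, |w q| ≤ B) (hT : IsTransported r m w)
    {G : ℝ × ℝ → ℝ} (hG : IsTest₂ G) : ∫ q, w q * r q * dτ G (ψ q, q.2) = 0 := by
  obtain ⟨A, hA0, hA⟩ := hasCompactSupport_bound hG.2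
  obtain ⟨A1, -, hA1⟩ := hasCompactSupport_bound hG.dy.2
  obtain ⟨A2, -, hA2⟩ := hasCompactSupport_bound hG.dτ.2
  obtain ⟨C1, hC1⟩ := hG.dy.continuous.bounded_above_of_compact_support hG.dy.2
  obtain ⟨C2, hC2⟩ := hG.dτ.continuous.bounded_above_of_compact_support hG.dτ.2
  -- A bound on the values at the origin uniform in n, needed to place all supports in one box.
  obtain ⟨D, hD⟩ := (Metric.isBounded_range_of_tendsto _ (hψ (0, 0))).exists_norm_le
  have hD' : ∀ n, |mollify n (massCoord ρ₀ m) (0, 0)| ≤ D := fun n => hD _ ⟨n, rfl⟩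
  set f := fun n => mollify n (massCoord ρ₀ m) with hf
  have hfs : ∀ n, ContDiff ℝ ∞ (f n) := fun n => mollify_contDiff n h.locallyIntegrable_massCoord
  have hfd : ∀ n, Differentiable ℝ (f n) := fun n => (hfs n).differentiable (by simp)
  have hr1 : ∀ n q, |mollify n r q| ≤ M := by
    intro n q
    rw [abs_le]
    exact ⟨(neg_nonpos.2 h.M_nonneg).trans
      (h.c_pos.le.trans (le_mollify n h.measurable_r h.abs_r_le h.le_r q)),
      mollify_le n h.measurable_r h.abs_r_le h.r_le q⟩
  have hm1 : ∀ n q, |mollify n m q| ≤ M := by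
    intro n q
    rw [abs_le]
    exact ⟨le_mollify n h.measurable_m h.abs_m_le (fun q => (abs_le.1 (h.abs_m_le q)).1) q,
      mollify_le n h.measurable_m h.abs_m_le (fun q => (abs_le.1 (h.abs_m_le q)).2) q⟩
  have hrl := locallyIntegrable_of_bdd h.measurable_r h.abs_r_le
  have hml := locallyIntegrable_of_bdd h.measurable_m h.abs_m_le
  have hφτ : ∀ n q, dτ (fun q => G (f n q, q.2)) q =
      - mollify n m q * dy G (f n q, q.2) + dτ G (f n q, q.2) := by
    intro n q
    have h1 := h.dτ_mollify n q
    simp only [dτ] at h1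
    rw [dτ, fderiv_comp_pair hG.differentiable (hfd n), hf]
    simp only [h1, one_mul]
  have hφy : ∀ n q, dy (fun q => G (f n q, q.2)) q = mollify n r q * dy G (f n q, q.2) := by
    intro n q
    have h1 := h.dy_mollify n q
    simp only [dy] at h1
    rw [dy, fderiv_comp_pair hG.differentiable (hfd n), hf]
    simp only [h1, zero_mul, add_zero]
  -- The mollified coordinate is smooth and proper, so G(ψₙ, t) is admissible in the transport
  -- equation; G(ψ, t) would only be Lipschitz.
  have htest : ∀ n, IsTest₂ (fun q => G (f n q, q.2)) := by
    intro n
    refine ⟨hG.1.comp ((hfs n).prodMk contDiff_snd), ?_⟩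
    apply hasCompactSupport_of_bound (A := max A ((A + D + M * A) / c))
    intro q hq
    have h1 := hA _ hq
    exact ⟨((h.hasSlopes_mollify n).abs_fst_le h.c_pos (hD' n) h1.1 h1.2).trans
      (le_max_right _ _), h1.2.trans (le_max_left _ _)⟩
  set A3 := max A1 A2 with hA3
  refine integral_eq_zero_of_tendsto
    (F := fun n q => w q * (r q * dτ (fun q => G (f n q, q.2)) q
      + m q * dy (fun q => G (f n q, q.2)) q))
    (A := max A3 ((A3 + D + M * A3) / c)) (C := B * (M * (M * C1 + C2) + M * (M * C1)))
    (fun n => ?_) (fun n q => ?_) (fun n q hq => ?_) ?_ (fun n => hT _ (htest n))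
  · exact hw.mul ((h.measurable_r.mul (htest n).dτ.continuous.measurable).add
      (h.measurable_m.mul (htest n).dy.continuous.measurable))
  · rw [hφτ, hφy]
    have b1 : |dy G (f n q, q.2)| ≤ C1 := hC1 _
    have b2 : |dτ G (f n q, q.2)| ≤ C2 := hC2 _
    have hM := h.M_nonneg
    have hC10 : 0 ≤ C1 := (abs_nonneg _).trans b1
    have hC20 : 0 ≤ C2 := (abs_nonneg _).trans b2
    have hB0 : 0 ≤ B := (abs_nonneg _).trans (hB q)
    rw [abs_mul]
    refine mul_le_mul (hB q) ?_ (abs_nonneg _) hB0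
    refine (abs_add_le _ _).trans (add_le_add ?_ ?_)
    · rw [abs_mul]
      refine mul_le_mul (h.abs_r_le q) ?_ (abs_nonneg _) hM
      refine (abs_add_le _ _).trans (add_le_add ?_ b2)
      rw [abs_mul, abs_neg]
      exact mul_le_mul (hm1 n q) b1 (abs_nonneg _) hM
    · rw [abs_mul]
      refine mul_le_mul (h.abs_m_le q) ?_ (abs_nonneg _) hM
      rw [abs_mul]
      exact mul_le_mul (hr1 n q) b1 (abs_nonneg _) hM
  · rw [hφτ, hφy] at hq
    have h1 : |f n q| ≤ A3 ∧ |q.2| ≤ A3 := by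
      by_cases g1 : dy G (f n q, q.2) = 0
      · have g2 : dτ G (f n q, q.2) ≠ 0 := fun g2 => hq (by rw [g1, g2]; ring)
        exact ⟨(hA2 _ g2).1.trans (le_max_right _ _), (hA2 _ g2).2.trans (le_max_right _ _)⟩
      · exact ⟨(hA1 _ g1).1.trans (le_max_left _ _), (hA1 _ g1).2.trans (le_max_left _ _)⟩
    exact ⟨((h.hasSlopes_mollify n).abs_fst_le h.c_pos (hD' n) h1.1 h1.2).trans
      (le_max_right _ _), h1.2.trans (le_max_left _ _)⟩
  -- Writing rₙ, mₙ for the mollifications, r(-mₙ ∂G + ∂ₜG) + m rₙ ∂G tends to r ∂ₜG: the two terms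
  -- with the derivative of G in the mass variable cancel in the limit.
  · filter_upwards [mollify_tendsto hrl, mollify_tendsto hml] with q hq1 hq2
    simp only [hφτ, hφy]
    have hpair : Tendsto (fun n => (f n q, q.2)) atTop (𝓝 (ψ q, q.2)) :=
      (hψ q).prodMk_nhds tendsto_const_nhds
    have t1 := (hG.dy.continuous.tendsto _).comp hpair
    have t2 := (hG.dτ.continuous.tendsto _).comp hpair
    have t3 := (((hq2.neg.mul t1).add t2).const_mul (r q)).add ((hq1.mul t1).const_mul (m q))
    have t4 := t3.const_mul (w q)
    refine t4.congr' (.of_forall fun n => rfl) |>.trans (le_of_eq ?_)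
    congr 1
    ring

end IsMassPair

/-- The function equal to `a` on `s ≤ 0` and to `b` on `s > 0`. -/
noncomputable def jump (a b s : ℝ) : ℝ := if s ≤ 0 then a else b

/-- Smooth approximations of `jump`. -/
noncomputable def smoothJump (a b : ℝ) (k : ℕ) (s : ℝ) : ℝ :=
  a + (b - a) * Real.smoothTransition (k * s)

theorem smoothJump_contDiff (a b : ℝ) (k : ℕ) : ContDiff ℝ ∞ (smoothJump a b k) :=
  contDiff_const.add (contDiff_const.mul
    (Real.smoothTransition.contDiff.comp (contDiff_const.mul contDiff_id)))

theorem smoothJump_tendsto (a b s : ℝ) :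
    Tendsto (fun k => smoothJump a b k s) atTop (𝓝 (jump a b s)) := by
  by_cases hs : s ≤ 0
  · refine tendsto_const_nhds.congr fun k => ?_
    rw [jump, if_pos hs, smoothJump, Real.smoothTransition.zero_of_nonpos, mul_zero, add_zero]
    exact mul_nonpos_of_nonneg_of_nonpos (Nat.cast_nonneg k) hs
  · rw [not_le] at hs
    rw [jump, if_neg (not_le.2 hs)]
    refine tendsto_const_nhds.congr' ?_
    obtain ⟨N, hN⟩ := exists_nat_ge (1 / s)
    filter_upwards [eventually_ge_atTop N] with k hk
    rw [smoothJump, Real.smoothTransition.one_of_one_le]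
    · ring
    · rw [div_le_iff₀ hs] at hN
      exact hN.trans (mul_le_mul_of_nonneg_right (by exact_mod_cast hk) hs.le)

theorem abs_smoothJump_le (a b : ℝ) (k : ℕ) (s : ℝ) : |smoothJump a b k s| ≤ |a| + |b - a| := by
  refine (abs_add_le _ _).trans (add_le_add le_rfl ?_)
  rw [abs_mul, abs_of_nonneg (Real.smoothTransition.nonneg _)]
  exact mul_le_of_le_one_right (abs_nonneg _) (Real.smoothTransition.le_one _)

theorem measurable_jump (a b : ℝ) : Measurable (jump a b) :=
  Measurable.ite measurableSet_Iic measurable_const measurable_const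

theorem abs_jump_le (a b s : ℝ) : |jump a b s| ≤ |a| + |b| := by
  unfold jump
  split_ifs
  · linarith [abs_nonneg b]
  · linarith [abs_nonneg a]

namespace IsMassPair

variable {c M ρ₀ : ℝ} {r m : ℝ × ℝ → ℝ}

theorem isTransported_one (h : IsMassPair c M ρ₀ r m) : IsTransported r m fun _ => 1 := by
  intro φ hφ
  simp only [one_mul]
  exact h.mass φ hφ

/-- A step function of the mass coordinate is transported. -/
theorem integral_jump (h : IsMassPair c M ρ₀ r m) {ψ : ℝ × ℝ → ℝ}
    (hψ : ∀ q, Tendsto (fun n => mollify n (massCoord ρ₀ m) q) atTop (𝓝 (ψ q)))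
    (hs : HasSlopes c M ψ) (a b : ℝ) {G : ℝ × ℝ → ℝ} (hG : IsTest₂ G) :
    ∫ q, jump a b (ψ q) * r q * dτ G (ψ q, q.2) = 0 := by
  obtain ⟨A, -, hA⟩ := hasCompactSupport_bound hG.dτ.2
  obtain ⟨C, hC⟩ := hG.dτ.continuous.bounded_above_of_compact_support hG.dτ.2
  have hψc := hs.continuous h.c_pos
  -- A factor depending on the mass variable alone commutes with the time derivative. It can be
  -- absorbed into the test function, which reduces the claim to transport of the constant 1, the
  -- mass equation.
  have hGk : ∀ k, IsTest₂ fun z => smoothJump a b k z.1 * G z := fun k =>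
    ⟨((smoothJump_contDiff a b k).comp contDiff_fst).mul hG.1, hG.2.mul_left⟩
  have hd : ∀ k z, dτ (fun z => smoothJump a b k z.1 * G z) z = smoothJump a b k z.1 * dτ G z := by
    intro k z
    have h1 := hasDerivAt_snd_slice (hGk k).differentiable z.1 z.2
    exact h1.unique ((hasDerivAt_snd_slice hG.differentiable z.1 z.2).const_mul
      (smoothJump a b k z.1))
  refine integral_eq_zero_of_tendsto
    (F := fun k q => smoothJump a b k (ψ q) * r q * dτ G (ψ q, q.2))
    (A := max A ((A + |ψ (0, 0)| + M * A) / c)) (C := (|a| + |b - a|) * M * C)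
    (fun k => ?_) (fun k q => ?_) (fun k q hq => ?_) (.of_forall fun q => ?_) fun k => ?_
  · exact ((((smoothJump_contDiff a b k).continuous.comp hψc).measurable).mul h.measurable_r).mul
      (hG.dτ.continuous.comp (hψc.prodMk continuous_snd)).measurable
  · rw [abs_mul, abs_mul]
    have hM := h.M_nonneg
    exact mul_le_mul (mul_le_mul (abs_smoothJump_le _ _ _ _) (h.abs_r_le q) (abs_nonneg _)
      (by positivity)) (hC _) (abs_nonneg _) (by positivity)
  · have h1 := hA _ (right_ne_zero_of_mul hq)
    exact ⟨(hs.abs_fst_le h.c_pos le_rfl h1.1 h1.2).trans (le_max_right _ _),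
      h1.2.trans (le_max_left _ _)⟩
  · exact ((smoothJump_tendsto a b (ψ q)).mul_const _).mul_const _
  · have := h.integral_transported hψ measurable_const (B := 1) (by simp) h.isTransported_one
      (hGk k)
    simp only [hd] at this
    rw [← this]
    congr 1
    ext q
    ring

/-- A function that vanishes when tested in mass coordinates vanishes. -/
theorem ae_eq_zero_of_integral_comp (h : IsMassPair c M ρ₀ r m) {u ψ : ℝ × ℝ → ℝ} {B : ℝ}
    (hs : HasSlopes c M ψ) (hu : Measurable u) (hB : ∀ q, |u q| ≤ B)
    (hK : ∀ K, IsTest₂ K → ∫ q, u q * r q * K (ψ q, q.2) = 0) : ∀ᵐ q, u q = 0 := by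
  have hur : Measurable fun q => u q * r q := hu.mul h.measurable_r
  have hB0 : 0 ≤ B := (abs_nonneg _).trans (hB 0)
  have hurB : ∀ q, |u q * r q| ≤ B * M := fun q => by
    rw [abs_mul]
    exact mul_le_mul (hB q) (h.abs_r_le q) (abs_nonneg _) hB0
  have hψc := hs.continuous h.c_pos
  obtain ⟨Y, hYc, hY1, hY2⟩ := hs.exists_inverse h.c_pos
  have key : ∀ᵐ q, u q * r q = 0 := by
    refine ae_eq_zero_of_integral_contDiff_smul_eq_zero (locallyIntegrable_of_bdd hur hurB) ?_
    intro κ hκs hκc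
    simp only [smul_eq_mul]
    obtain ⟨A, hA0, hA⟩ := hasCompactSupport_bound hκc
    obtain ⟨C, hC⟩ := hκs.continuous.bounded_above_of_compact_support hκc
    -- An arbitrary test function κ is written as g(ψ, t) using the inverse coordinates. This g is
    -- only continuous, so it is approximated by its mollifications, to which the hypothesis
    -- applies.
    set g : ℝ × ℝ → ℝ := fun z => κ (Y z, z.2) with hg
    have hgc : Continuous g := hκs.continuous.comp (hYc.prodMk continuous_snd)
    set A' := A + (M * A + M * A + |ψ (0, 0)|) with hA'
    have hM := h.M_nonneg
    have hgA : ∀ z, g z ≠ 0 → |z.1| ≤ A' ∧ |z.2| ≤ A' := by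
      intro z hz
      have h1 := hA _ hz
      have e1 := hs.abs_upper h.c_pos (Y z) 0 z.2
      have e2 := hs.time 0 z.2 0
      have e3 := mul_le_mul_of_nonneg_left h1.1 hM
      have e4 := mul_le_mul_of_nonneg_left h1.2 hM
      rw [hY1] at e1
      simp only [sub_zero] at e1 e2 e3 e4
      have e5 := abs_add_le (z.1 - ψ (0, z.2)) (ψ (0, z.2) - ψ (0, 0) + ψ (0, 0))
      have e6 := abs_add_le (ψ (0, z.2) - ψ (0, 0)) (ψ (0, 0))
      rw [sub_add_cancel] at e5 e6
      rw [sub_add_cancel] at e5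
      have h12 : |z.2| ≤ A := h1.2
      have : 0 ≤ M * A + M * A + |ψ (0, 0)| := by positivity
      exact ⟨by linarith, by linarith⟩
    have hgC : ∀ z, |g z| ≤ C := fun z => hC _
    have hgs : HasCompactSupport g := hasCompactSupport_of_bound hgA
    have hKn : ∀ n, IsTest₂ (mollify n g) := fun n =>
      ⟨mollify_contDiff n hgc.locallyIntegrable,
        (mollifier_isTest n).2.convolution _ hgs⟩
    have hKC : ∀ n z, |mollify n g z| ≤ C := fun n z => by
      rw [abs_le]
      exact ⟨le_mollify n hgc.measurable hgC (fun z => (abs_le.1 (hgC z)).1) z,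
        mollify_le n hgc.measurable hgC (fun z => (abs_le.1 (hgC z)).2) z⟩
    have hKA : ∀ n z, mollify n g z ≠ 0 → |z.1| ≤ A' + 2 ∧ |z.2| ≤ A' + 2 := by
      intro n z hz
      rw [mollify_apply] at hz
      have : ∃ q, g q * mollifier n (z - q) ≠ 0 := by
        by_contra! hcon
        exact hz (by simp [hcon])
      obtain ⟨q, hq⟩ := this
      have h1 := hgA q (left_ne_zero_of_mul hq)
      have h2 : z - q ∈ Metric.ball (0 : ℝ × ℝ) (bump n).rOut := by
        rw [← (bump n).support_normed_eq (μ := volume)]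
        exact right_ne_zero_of_mul hq
      rw [mem_ball_zero_iff] at h2
      have h3 : (bump n).rOut ≤ 2 := by
        have : 1 / ((n : ℝ) + 1) ≤ 1 := by
          rw [div_le_one (by positivity)]
          linarith [(Nat.cast_nonneg n : (0 : ℝ) ≤ n)]
        simp only [bump]
        linarith
      have h4 : |z.1 - q.1| ≤ ‖z - q‖ := le_max_left ‖(z - q).1‖ ‖(z - q).2‖
      have h5 : |z.2 - q.2| ≤ ‖z - q‖ := le_max_right ‖(z - q).1‖ ‖(z - q).2‖
      have h6 := abs_add_le (z.1 - q.1) q.1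
      have h7 := abs_add_le (z.2 - q.2) q.2
      rw [sub_add_cancel] at h6 h7
      exact ⟨by linarith, by linarith⟩
    have hκg : ∀ q, κ q * (u q * r q) = u q * r q * g (ψ q, q.2) := by
      intro q
      simp only [hg, hY2, Prod.mk.eta]
      ring
    simp only [hκg]
    refine integral_eq_zero_of_tendsto (F := fun n q => u q * r q * mollify n g (ψ q, q.2))
      (A := max (A' + 2) ((A' + 2 + |ψ (0, 0)| + M * (A' + 2)) / c)) (C := B * M * C)
      (fun n => ?_) (fun n q => ?_) (fun n q hq => ?_) (.of_forall fun q => ?_)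
      fun n => hK _ (hKn n)
    · exact hur.mul ((hKn n).continuous.comp (hψc.prodMk continuous_snd)).measurable
    · rw [abs_mul]
      exact mul_le_mul (hurB q) (hKC _ _) (abs_nonneg _) (by positivity)
    · have h1 := hKA n _ (right_ne_zero_of_mul hq)
      exact ⟨(hs.abs_fst_le h.c_pos le_rfl h1.1 h1.2).trans (le_max_right _ _),
        h1.2.trans (le_max_left _ _)⟩
    · exact (mollify_tendsto_of_continuous hgc _).const_mul _
  filter_upwards [key] with q hq
  exact (mul_eq_zero.1 hq).resolve_right (h.c_pos.trans_le (h.le_r q)).ne'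

/-- A transported quantity with step initial data is a step function of the mass coordinate. -/
theorem ae_eq_jump (h : IsMassPair c M ρ₀ r m) {w : ℝ × ℝ → ℝ} {B a b : ℝ}
    (hw : Measurable w) (hB : ∀ q, |w q| ≤ B) (hT : IsTransported r m w)
    (hpast : ∀ q, q.2 ≤ 0 → w q = jump a b q.1) :
    ∀ᵐ q, w q = jump a b (massCoord ρ₀ m q) := by
  obtain ⟨ψ, hψ, hψae, hs⟩ := h.exists_continuous_massCoord
  have hψc := hs.continuous h.c_pos
  have hρ : 0 < ρ₀ := by
    rw [← h.r_past (0, 0) le_rfl]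
    exact h.c_pos.trans_le (h.le_r _)
  have hjm : Measurable fun q => jump a b (ψ q) := (measurable_jump a b).comp hψc.measurable
  have hu : Measurable fun q => w q - jump a b (ψ q) := hw.sub hjm
  have huB : ∀ q, |w q - jump a b (ψ q)| ≤ B + (|a| + |b|) := fun q =>
    (abs_sub _ _).trans (add_le_add (hB q) (abs_jump_le _ _ _))
  -- For t ≤ 0 nothing has crossed, so the mass coordinate is ρ₀ y, with the sign of y.
  have hu0 : ∀ᵐ q : ℝ × ℝ, q.2 ≤ 0 → w q - jump a b (ψ q) = 0 := by
    filter_upwards [hψae] with q hq hq2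
    rw [hpast q hq2, hq, massCoord, h.crossed_eq, Ioo_eq_empty (not_lt.2 hq2)]
    simp only [setIntegral_empty, sub_zero, jump]
    have : ρ₀ * q.1 ≤ 0 ↔ q.1 ≤ 0 := by
      constructor <;> intro h0 <;> nlinarith
    simp [this]
  have key := h.ae_eq_zero_of_integral_comp hs hu huB (fun K hK => ?_)
  · filter_upwards [key, hψae] with q h1 h2
    rw [← h2]
    exact sub_eq_zero.1 h1
  -- Both w and the step function have vanishing time derivative in mass coordinates. Testing their
  -- difference with a time antiderivative of K leaves the pairing with K, because the difference
  -- already vanishes for t ≤ 0.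
  · have hG := antideriv_isTest hK
    have e1 := h.integral_transported hψ hw hB hT hG
    have e2 := h.integral_jump hψ hs a b hG
    obtain ⟨A, -, hA⟩ := hasCompactSupport_bound hG.dτ.2
    have hcs : HasCompactSupport fun q : ℝ × ℝ => dτ (antideriv K) (ψ q, q.2) := by
      apply hasCompactSupport_of_bound (A := max A ((A + |ψ (0, 0)| + M * A) / c))
      intro q hq
      have h1 := hA _ hq
      exact ⟨(hs.abs_fst_le h.c_pos le_rfl h1.1 h1.2).trans (le_max_right _ _),
        h1.2.trans (le_max_left _ _)⟩
    have hcont : Continuous fun q : ℝ × ℝ => dτ (antideriv K) (ψ q, q.2) :=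
      hG.dτ.continuous.comp (hψc.prodMk continuous_snd)
    have i1 : Integrable fun q => w q * r q * dτ (antideriv K) (ψ q, q.2) :=
      integrable_bdd_mul (M := B * M) (hw.mul h.measurable_r) (fun q => by
        rw [abs_mul]
        exact mul_le_mul (hB q) (h.abs_r_le q) (abs_nonneg _) ((abs_nonneg _).trans (hB q)))
        hcont hcs
    have i2 : Integrable fun q => jump a b (ψ q) * r q * dτ (antideriv K) (ψ q, q.2) :=
      integrable_bdd_mul (M := (|a| + |b|) * M) (hjm.mul h.measurable_r) (fun q => by
        rw [abs_mul]
        exact mul_le_mul (abs_jump_le _ _ _) (h.abs_r_le q) (abs_nonneg _) (by positivity))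
        hcont hcs
    have e3 := integral_sub i1 i2
    rw [e1, e2, sub_zero] at e3
    rw [← e3]
    refine integral_congr_ae ?_
    filter_upwards [hu0] with q hq
    by_cases hq2 : q.2 ≤ 0
    · rw [hq hq2, ← sub_mul, ← sub_mul, hq hq2]
      ring
    · rw [dτ_antideriv hK (by dsimp only; linarith)]
      ring

end IsMassPair

/-! ### The relative energy of a pressure law -/

theorem IsPressureLaw.pos_dslope {p : ℝ → ℝ} (hp : IsPressureLaw p) {ρ₀ x : ℝ} (h0 : 0 < ρ₀)
    (hx : 0 < x) : 0 < dslope p ρ₀ x := by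
  have hmono : StrictMonoOn p (Ioi 0) := by
    refine strictMonoOn_of_deriv_pos (convex_Ioi 0) ?_ ?_
    · exact fun y hy => (hp y hy).2.1.continuousAt.continuousWithinAt
    · intro y hy
      rw [interior_Ioi] at hy
      exact (hp y hy).2.2
  rcases eq_or_ne x ρ₀ with rfl | hne
  · rw [dslope_same]
    exact (hp x hx).2.2
  · rw [dslope_of_ne _ hne, slope_def_field]
    rcases lt_or_gt_of_ne hne with h | h
    · exact div_pos_of_neg_of_neg (sub_neg.2 (hmono hx h0 h)) (sub_neg.2 h)
    · exact div_pos (sub_pos.2 (hmono h0 hx h)) (sub_pos.2 h)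

/-- The density part of the relative energy with respect to the constant density `ρ₀`. -/
noncomputable def relEnergy (p ε : ℝ → ℝ) (ρ₀ x : ℝ) : ℝ :=
  x * ε x - x * ε ρ₀ - p ρ₀ * (x - ρ₀) / ρ₀

/-- On a compact interval the relative energy controls the squares of the differences of
densities and of pressures. -/
theorem exists_relEnergy_bound {p ε : ℝ → ℝ} (hp : IsPressureLaw p) (hε : IsInternalEnergy p ε)
    {c M ρ₀ : ℝ} (hc : 0 < c) (hc0 : c ≤ ρ₀) (hM : ρ₀ ≤ M) :
    ∃ C k : ℝ, 0 ≤ C ∧ 0 < k ∧ ∀ x, c ≤ x → x ≤ M →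
      k * (x - ρ₀) ^ 2 ≤ relEnergy p ε ρ₀ x ∧
        (p x - p ρ₀) ^ 2 ≤ C * relEnergy p ε ρ₀ x := by
  have h0 : 0 < ρ₀ := hc.trans_le hc0
  have hMpos : 0 < M := h0.trans_le hM
  -- The derivative p' need not be continuous, but the difference quotient at the fixed point ρ₀ is,
  -- even at ρ₀ itself. Being positive, it has positive extrema k and K on [c, M].
  have hcont : ContinuousOn (dslope p ρ₀) (Icc c M) := by
    have : ContinuousOn (dslope p ρ₀) (Ioi 0) := by
      rw [continuousOn_dslope (Ioi_mem_nhds h0)]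
      exact ⟨fun y hy => (hp y hy).2.1.continuousAt.continuousWithinAt, (hp ρ₀ h0).2.1⟩
    exact this.mono fun y hy => hc.trans_le hy.1
  obtain ⟨x₁, hx₁, hmin⟩ := isCompact_Icc.exists_isMinOn ⟨ρ₀, hc0, hM⟩ hcont
  obtain ⟨x₂, hx₂, hmax⟩ := isCompact_Icc.exists_isMaxOn ⟨ρ₀, hc0, hM⟩ hcont
  set k := dslope p ρ₀ x₁ with hk
  set K := dslope p ρ₀ x₂ with hK
  have hkpos : 0 < k := hp.pos_dslope h0 (hc.trans_le hx₁.1)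
  have hKpos : 0 < K := hp.pos_dslope h0 (hc.trans_le hx₂.1)
  have hsl : ∀ x, p x - p ρ₀ = dslope p ρ₀ x * (x - ρ₀) := by
    intro x
    have := sub_smul_dslope p ρ₀ x
    rw [smul_eq_mul] at this
    linarith
  -- This is `relEnergy` divided by x, less a quadratic. Its derivative is (x - ρ₀)(`dslope p ρ₀ x`
  -- / x² - k / M²), which on [c, M] has the sign of x - ρ₀, so f is minimal at ρ₀, where it
  -- vanishes.
  set f : ℝ → ℝ := fun x => ε x - ε ρ₀ - p ρ₀ * (1 / ρ₀ - 1 / x) - k / (2 * M ^ 2) * (x - ρ₀) ^ 2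
    with hf
  have hfd : ∀ x, 0 < x → HasDerivAt f ((p x - p ρ₀) / x ^ 2 - k / M ^ 2 * (x - ρ₀)) x := by
    intro x hx
    have e1 := (hε x hx).1.hasDerivAt
    have e2 : HasDerivAt (fun x : ℝ => 1 / x) (-(x ^ 2)⁻¹) x := by
      simpa [one_div] using hasDerivAt_inv hx.ne'
    have e3 := ((hasDerivAt_id x).sub_const ρ₀).pow 2
    have e4 := ((e1.sub_const (ε ρ₀)).sub ((e2.const_sub (1 / ρ₀)).const_mul (p ρ₀))).sub
      (e3.const_mul (k / (2 * M ^ 2)))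
    refine e4.congr_deriv ?_
    rw [(hε x hx).2]
    simp only [id]
    field_simp
    ring
  have hf0 : f ρ₀ = 0 := by simp [hf]
  have hfpos : ∀ x, c ≤ x → x ≤ M → 0 ≤ f x := by
    intro x hcx hxM
    rcases le_total ρ₀ x with hle | hle
    · have : MonotoneOn f (Icc ρ₀ x) := by
        refine monotoneOn_of_hasDerivWithinAt_nonneg (convex_Icc _ _)
          (fun y hy => (hfd y (h0.trans_le hy.1)).continuousAt.continuousWithinAt)
          (fun y hy => (hfd y (h0.trans_le (interior_subset hy).1)).hasDerivWithinAt) ?_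
        intro y hy
        have hy := interior_subset hy
        have hy0 : 0 < y := h0.trans_le hy.1
        have hyk : k ≤ dslope p ρ₀ y := hmin ⟨hc0.trans hy.1, hy.2.trans hxM⟩
        have : k / M ^ 2 ≤ dslope p ρ₀ y / y ^ 2 :=
          div_le_div₀ (hkpos.le.trans hyk) hyk (by positivity)
            (pow_le_pow_left₀ hy0.le (hy.2.trans hxM) 2)
        rw [hsl, mul_div_right_comm, ← sub_mul]
        exact mul_nonneg (sub_nonneg.2 this) (sub_nonneg.2 hy.1)
      rw [← hf0]
      exact this (left_mem_Icc.2 hle) (right_mem_Icc.2 hle) hle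
    · have : AntitoneOn f (Icc x ρ₀) := by
        refine antitoneOn_of_hasDerivWithinAt_nonpos (convex_Icc _ _)
          (fun y hy => (hfd y (hc.trans_le (hcx.trans hy.1))).continuousAt.continuousWithinAt)
          (fun y hy => (hfd y
            (hc.trans_le (hcx.trans (interior_subset hy).1))).hasDerivWithinAt) ?_
        intro y hy
        have hy := interior_subset hy
        have hy0 : 0 < y := hc.trans_le (hcx.trans hy.1)
        have hyk : k ≤ dslope p ρ₀ y := hmin ⟨hcx.trans hy.1, hy.2.trans hM⟩
        have : k / M ^ 2 ≤ dslope p ρ₀ y / y ^ 2 :=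
          div_le_div₀ (hkpos.le.trans hyk) hyk (by positivity)
            (pow_le_pow_left₀ hy0.le (hy.2.trans hM) 2)
        rw [hsl, mul_div_right_comm, ← sub_mul]
        exact mul_nonpos_of_nonneg_of_nonpos (sub_nonneg.2 this) (sub_nonpos.2 hy.2)
      rw [← hf0]
      exact this (left_mem_Icc.2 hle) (right_mem_Icc.2 hle) hle
  -- The factor c is the lower bound for x when f is multiplied back by x.
  set k' := c * (k / (2 * M ^ 2)) with hk'
  have hk'pos : 0 < k' := by positivity
  refine ⟨K ^ 2 / k', k', by positivity, hk'pos, fun x hcx hxM => ?_⟩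
  have hx0 : 0 < x := hc.trans_le hcx
  have e1 : k' * (x - ρ₀) ^ 2 ≤ relEnergy p ε ρ₀ x := by
    have h1 := hfpos x hcx hxM
    have h2 : relEnergy p ε ρ₀ x = x * (f x + k / (2 * M ^ 2) * (x - ρ₀) ^ 2) := by
      simp only [relEnergy, hf]
      field_simp
      ring
    rw [h2, hk', mul_assoc]
    have h3 : 0 ≤ k / (2 * M ^ 2) * (x - ρ₀) ^ 2 := by positivity
    exact (mul_le_mul_of_nonneg_right hcx h3).trans
      (mul_le_mul_of_nonneg_left (by linarith) hx0.le)
  refine ⟨e1, ?_⟩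
  have h4 : dslope p ρ₀ x ≤ K := hmax ⟨hcx, hxM⟩
  have h5 : 0 ≤ dslope p ρ₀ x := (hp.pos_dslope h0 hx0).le
  rw [hsl, mul_pow]
  calc dslope p ρ₀ x ^ 2 * (x - ρ₀) ^ 2 ≤ K ^ 2 * (x - ρ₀) ^ 2 :=
        mul_le_mul_of_nonneg_right (pow_le_pow_left₀ h5 h4 2) (sq_nonneg _)
    _ = K ^ 2 / k' * (k' * (x - ρ₀) ^ 2) := by field_simp
    _ ≤ _ := mul_le_mul_of_nonneg_left e1 (by positivity)

/-! ### Finite speed of propagation -/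

/-- If `E ≥ 0` satisfies `∂ₜ E + ∂_y Q ≤ 0` with vanishing initial values and `|Q| ≤ L E`, then
`E` vanishes. -/
theorem ae_eq_zero_of_finite_speed {E Q : ℝ × ℝ → ℝ} {L B : ℝ} (hE : Measurable E)
    (hQ : Measurable Q) (hEB : ∀ q, |E q| ≤ B) (hQE : ∀ q, |Q q| ≤ L * E q) (hL : 0 ≤ L)
    (hE0 : ∀ q, 0 ≤ E q)
    (hineq : ∀ φ, IsTest₂ φ → (∀ q, 0 ≤ φ q) → 0 ≤ ∫ q in upper₂, (E q * dτ φ q + Q q * dy φ q)) :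
    ∀ᵐ q ∂(volume.restrict upper₂), E q = 0 := by
  have hQB : ∀ q, |Q q| ≤ L * B := fun q => (hQE q).trans
    (mul_le_mul_of_nonneg_left ((le_abs_self _).trans (hEB q)) hL)
  -- A smooth profile that vanishes on s ≤ 0 and has positive derivative on s > 0.
  set G := expNegInvGlue with hG
  have hGs : ContDiff ℝ ∞ G := expNegInvGlue.contDiff
  have hGmono : ∀ s, 0 < s → 0 < deriv G s := by
    intro s hs
    have h1 : HasDerivAt (fun s : ℝ => Real.exp (-s⁻¹)) (Real.exp (-s⁻¹) * -(-(s ^ 2)⁻¹)) s :=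
      (hasDerivAt_inv hs.ne').neg.exp
    have h2 : G =ᶠ[𝓝 s] fun s : ℝ => Real.exp (-s⁻¹) := by
      filter_upwards [lt_mem_nhds hs] with x hx
      simp [hG, expNegInvGlue, not_le.2 hx]
    rw [(h1.congr_of_eventuallyEq h2).deriv]
    have : 0 < (s ^ 2)⁻¹ := by positivity
    rw [neg_neg]
    positivity
  have hGneg : ∀ s, s ≤ 0 → G s = 0 := fun s hs => expNegInvGlue.zero_of_nonpos hs
  have hGd0 : ∀ s, 0 ≤ deriv G s := by
    intro s
    rcases lt_or_ge 0 s with hs | hs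
    · exact (hGmono s hs).le
    · rcases hs.lt_or_eq with hs | rfl
      · have : G =ᶠ[𝓝 s] fun _ => 0 := by
          filter_upwards [gt_mem_nhds hs] with x hx
          exact hGneg x hx.le
        rw [this.deriv_eq]
        simp
      · have h1 : IsLocalMin G 0 := .of_forall fun x => by
          rw [hGneg 0 le_rfl]; exact expNegInvGlue.nonneg x
        rw [h1.deriv_eq_zero]
  have cone : ∀ N : ℕ, ∀ᵐ q ∂(volume.restrict upper₂),
      0 < (N : ℝ) - (L + 1) * q.2 - Real.sqrt (1 + q.1 ^ 2) → E q = 0 := by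
    intro N
    -- S > 0 is a backward cone, with √(1 + y²) as a smooth substitute for |y|, of slope at most 1.
    -- Its speed L + 1 exceeds L by 1, and this margin leaves the term -E G'(S) in `hpt`.
    set S : ℝ × ℝ → ℝ := fun q => (N : ℝ) - (L + 1) * q.2 - Real.sqrt (1 + q.1 ^ 2) with hS
    have hSs : ContDiff ℝ ∞ S := by
      refine (contDiff_const.sub (contDiff_const.mul contDiff_snd)).sub ?_
      refine ContDiff.sqrt (contDiff_const.add (contDiff_fst.pow 2)) fun q => ?_
      positivity
    -- The time cut-off bounds the support from below in t and is invisible on t > 0.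
    set φ : ℝ × ℝ → ℝ := fun q => timeCutoff q.2 * G (S q) with hφ
    have hφt : IsTest₂ φ := by
      refine ⟨(timeCutoff_contDiff.comp contDiff_snd).mul (hGs.comp hSs), ?_⟩
      apply hasCompactSupport_of_bound (A := (N : ℝ) + 2 * (L + 1) + 2)
      intro q hq
      have h1 : -2 < q.2 := by
        by_contra h2
        exact hq (by simp [hφ, timeCutoff_eq_zero (not_lt.1 h2)])
      have h2 : 0 < S q := by
        by_contra h2
        exact hq (by simp [hφ, hGneg _ (not_lt.1 h2)])
      have h3 : |q.1| ≤ Real.sqrt (1 + q.1 ^ 2) := by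
        rw [← Real.sqrt_sq_eq_abs]
        exact Real.sqrt_le_sqrt (by linarith)
      have h4 : 0 ≤ |q.1| := abs_nonneg _
      simp only [hS] at h2
      have hN : (0 : ℝ) ≤ N := Nat.cast_nonneg N
      refine ⟨by nlinarith, abs_le.2 ⟨by nlinarith, ?_⟩⟩
      by_contra! hlt
      nlinarith
    have hφ0 : ∀ q, 0 ≤ φ q := fun q =>
      mul_nonneg (Real.smoothTransition.nonneg _) (expNegInvGlue.nonneg _)
    have hφe : ∀ q ∈ upper₂, φ =ᶠ[𝓝 q] fun q => G (S q) := by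
      intro q hq
      have hq' : -1 < q.2 := lt_trans (by norm_num) (show 0 < q.2 from hq)
      have : ∀ᶠ z : ℝ × ℝ in 𝓝 q, -1 < z.2 :=
        continuous_snd.continuousAt.eventually (lt_mem_nhds hq')
      filter_upwards [this] with z hz
      simp only [hφ]
      rw [timeCutoff_eq_one hz.le, one_mul]
    have hGS : Differentiable ℝ fun q => G (S q) := (hGs.comp hSs).differentiable (by simp)
    have hGd : Differentiable ℝ G := hGs.differentiable (by simp)
    have hdτ : ∀ q ∈ upper₂, dτ φ q = - ((L + 1) * deriv G (S q)) := by
      intro q hq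
      rw [dτ, (hφe q hq).fderiv_eq]
      have h1 := hasDerivAt_snd_slice hGS q.1 q.2
      refine h1.unique ?_
      have h2 : HasDerivAt (fun t => S (q.1, t)) (-((L + 1) * 1)) q.2 :=
        (((hasDerivAt_id q.2).const_mul (L + 1)).const_sub (N : ℝ)).sub_const
          (Real.sqrt (1 + q.1 ^ 2))
      refine ((hGd (S q)).hasDerivAt.comp q.2 h2).congr_deriv ?_
      ring
    have hdy : ∀ q ∈ upper₂, |dy φ q| ≤ deriv G (S q) := by
      intro q hq
      have hpos : 0 < 1 + q.1 ^ 2 := by positivity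
      have : dy φ q = deriv G (S q) * (-(2 * q.1 / (2 * Real.sqrt (1 + q.1 ^ 2)))) := by
        rw [dy, (hφe q hq).fderiv_eq]
        have h1 := hasDerivAt_fst_slice hGS q.1 q.2
        refine h1.unique ?_
        have h2 : HasDerivAt (fun y => 1 + y ^ 2) (2 * q.1) q.1 := by
          simpa using ((hasDerivAt_id q.1).pow 2).const_add 1
        have h3 : HasDerivAt (fun y => S (y, q.2))
            (-(2 * q.1 / (2 * Real.sqrt (1 + q.1 ^ 2)))) q.1 :=
          (h2.sqrt hpos.ne').const_sub ((N : ℝ) - (L + 1) * q.2)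
        exact (hGd (S q)).hasDerivAt.comp q.1 h3
      rw [this, abs_mul, abs_of_nonneg (hGd0 _), abs_neg]
      refine mul_le_of_le_one_right (hGd0 _) ?_
      rw [mul_div_mul_left _ _ two_ne_zero, abs_div, abs_of_nonneg (Real.sqrt_nonneg _)]
      refine div_le_one_of_le₀ ?_ (Real.sqrt_nonneg _)
      rw [← Real.sqrt_sq_eq_abs]
      exact Real.sqrt_le_sqrt (by linarith)
    have hpt : ∀ q ∈ upper₂, E q * dτ φ q + Q q * dy φ q ≤ - (E q * deriv G (S q)) := by
      intro q hq
      have h1 : Q q * dy φ q ≤ L * E q * deriv G (S q) := by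
        refine (le_abs_self _).trans ?_
        rw [abs_mul]
        exact mul_le_mul (hQE q) (hdy q hq) (abs_nonneg _) (mul_nonneg hL (hE0 q))
      rw [hdτ q hq]
      linarith
    have hi : IntegrableOn (fun q => E q * dτ φ q + Q q * dy φ q) upper₂ :=
      ((integrable_bdd_mul hE hEB hφt.dτ.continuous hφt.dτ.2).add
        (integrable_bdd_mul hQ hQB hφt.dy.continuous hφt.dy.2)).integrableOn
    have hi0 := hineq φ hφt hφ0
    have hneg : 0 ≤ᵐ[volume.restrict upper₂] fun q => - (E q * dτ φ q + Q q * dy φ q) := by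
      filter_upwards [ae_restrict_mem measurableSet_upper₂] with q hq
      have := hpt q hq
      have h2 := mul_nonneg (hE0 q) (hGd0 (S q))
      simp only [Pi.zero_apply]
      linarith
    -- The cone estimate makes the integrand in `hineq` nonpositive, while its integral is
    -- nonnegative; so it vanishes almost everywhere, and with it E G'(S).
    have hz : ∫ q in upper₂, - (E q * dτ φ q + Q q * dy φ q) = 0 := by
      refine le_antisymm ?_ (integral_nonneg_of_ae hneg)
      rw [integral_neg]
      linarith
    rw [integral_eq_zero_iff_of_nonneg_ae hneg hi.neg] at hz
    filter_upwards [hz, ae_restrict_mem measurableSet_upper₂] with q h1 hq hSq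
    have h2 := hpt q hq
    simp only [Pi.zero_apply] at h1
    have h3 : E q * deriv G (S q) ≤ 0 := by linarith
    have h4 := hGmono _ hSq
    refine le_antisymm ?_ (hE0 q)
    by_contra! hlt
    exact absurd h3 (not_le.2 (mul_pos hlt h4))
  filter_upwards [ae_all_iff.2 cone] with q hq
  obtain ⟨N, hN⟩ := exists_nat_gt ((L + 1) * q.2 + Real.sqrt (1 + q.1 ^ 2))
  exact hq N (by linarith)

/-! ### Bounded coefficients and extension of weak solutions to the past -/

/-- Bounded measurable functions. -/
def BddMeas {X : Type*} [MeasurableSpace X] (g : X → ℝ) : Prop :=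
  Measurable g ∧ ∃ B, ∀ x, |g x| ≤ B

namespace BddMeas

variable {X : Type*} [MeasurableSpace X] {f g : X → ℝ}

theorem add (hf : BddMeas f) (hg : BddMeas g) : BddMeas fun x => f x + g x := by
  obtain ⟨A, hA⟩ := hf.2
  obtain ⟨B, hB⟩ := hg.2
  exact ⟨hf.1.add hg.1, A + B, fun x => (abs_add_le _ _).trans (add_le_add (hA x) (hB x))⟩

theorem mul (hf : BddMeas f) (hg : BddMeas g) : BddMeas fun x => f x * g x := by
  obtain ⟨A, hA⟩ := hf.2
  obtain ⟨B, hB⟩ := hg.2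
  refine ⟨hf.1.mul hg.1, A * B, fun x => ?_⟩
  rw [abs_mul]
  exact mul_le_mul (hA x) (hB x) (abs_nonneg _) ((abs_nonneg _).trans (hA x))

theorem const (a : ℝ) : BddMeas fun _ : X => a := ⟨measurable_const, |a|, fun _ => le_rfl⟩

theorem sub (hf : BddMeas f) (hg : BddMeas g) : BddMeas fun x => f x - g x := by
  have := hf.add ((const (X := X) (-1)).mul hg)
  convert this using 2
  ring

theorem sq (hf : BddMeas f) : BddMeas fun x => f x ^ 2 := by
  simpa only [pow_two] using hf.mul hf

theorem div_const (hf : BddMeas f) (a : ℝ) : BddMeas fun x => f x / a := by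
  simpa only [div_eq_mul_inv] using hf.mul (const a⁻¹)

/-- Composition with a function that is continuous on `(0, ∞)`. -/
theorem comp_continuousOn {p : ℝ → ℝ} (hp : ContinuousOn p (Ioi 0)) {c M : ℝ} (hc : 0 < c)
    (hf : Measurable f) (h1 : ∀ x, c ≤ f x) (h2 : ∀ x, f x ≤ M) : BddMeas fun x => p (f x) := by
  constructor
  · have h3 : Continuous fun s => p (max c s) :=
      hp.comp_continuous (continuous_const.max continuous_id) fun s =>
        hc.trans_le (le_max_left c s)
    have h4 : (fun x => p (f x)) = fun x => p (max c (f x)) := by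
      ext x
      rw [max_eq_right (h1 x)]
    rw [h4]
    exact h3.measurable.comp hf
  · obtain ⟨B, hB⟩ := isCompact_Icc.exists_bound_of_continuousOn
      (hp.mono fun s (hs : s ∈ Icc c M) => hc.trans_le hs.1)
    exact ⟨B, fun x => hB _ ⟨h1 x, h2 x⟩⟩

theorem integrable_mul {X : Type*} [TopologicalSpace X] [MeasurableSpace X] [BorelSpace X]
    [SecondCountableTopology X] {μ : Measure X} [IsFiniteMeasureOnCompacts μ] {g φ : X → ℝ}
    (hg : BddMeas g) (hφ : Continuous φ) (hc : HasCompactSupport φ) :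
    Integrable (fun x => g x * φ x) μ := by
  obtain ⟨B, hB⟩ := hg.2
  exact integrable_bdd_mul hg.1 hB hφ hc

end BddMeas

theorem integrable_weak {Q F φ : ℝ × ℝ → ℝ} (hQ : BddMeas Q) (hF : BddMeas F) (hφ : IsTest₂ φ) :
    Integrable fun q => Q q * dτ φ q + F q * dy φ q :=
  (hQ.integrable_mul hφ.dτ.continuous hφ.dτ.2).add (hF.integrable_mul hφ.dy.continuous hφ.dy.2)

theorem integral_linear_combination {X : Type*} [MeasurableSpace X] {μ : Measure X}
    {f₁ f₂ f₃ f₄ f₅ : X → ℝ} (h₁ : Integrable f₁ μ) (h₂ : Integrable f₂ μ) (h₃ : Integrable f₃ μ)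
    (h₄ : Integrable f₄ μ) (h₅ : Integrable f₅ μ) (a₂ a₃ a₄ a₅ : ℝ) :
    ∫ x, (f₁ x + a₂ * f₂ x + a₃ * f₃ x + a₄ * f₄ x + a₅ * f₅ x) ∂μ
      = (∫ x, f₁ x ∂μ) + a₂ * (∫ x, f₂ x ∂μ) + a₃ * (∫ x, f₃ x ∂μ) + a₄ * (∫ x, f₄ x ∂μ)
        + a₅ * (∫ x, f₅ x ∂μ) := by
  have j₂ : Integrable (fun x => f₁ x + a₂ * f₂ x) μ := h₁.add (h₂.const_mul a₂)
  have j₃ : Integrable (fun x => f₁ x + a₂ * f₂ x + a₃ * f₃ x) μ := j₂.add (h₃.const_mul a₃)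
  have j₄ : Integrable (fun x => f₁ x + a₂ * f₂ x + a₃ * f₃ x + a₄ * f₄ x) μ :=
    j₃.add (h₄.const_mul a₄)
  rw [integral_add j₄ (h₅.const_mul a₅), integral_add j₃ (h₄.const_mul a₄),
    integral_add j₂ (h₃.const_mul a₃), integral_add h₁ (h₂.const_mul a₂)]
  simp only [integral_const_mul]

/-- Extending a solution on `t > 0` with initial data `g` by `g` to `t ≤ 0`. -/
theorem integral_extend {Q F φ : ℝ × ℝ → ℝ} {g : ℝ → ℝ} (hg : BddMeas g) (hφ : IsTest₂ φ)
    (h : (∫ q in upper₂, (Q q * dτ φ q + F q * dy φ q)) + ∫ y, g y * φ (y, 0) = 0)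
    {Q' F' : ℝ × ℝ → ℝ} (hQ' : BddMeas Q') (hF' : BddMeas F')
    (h1 : ∀ q ∈ upper₂, Q' q = Q q) (h2 : ∀ q ∈ upper₂, F' q = F q)
    (h3 : ∀ q, q.2 ≤ 0 → Q' q = g q.1) (h4 : ∀ q, q.2 ≤ 0 → F' q = 0) :
    ∫ q, (Q' q * dτ φ q + F' q * dy φ q) = 0 := by
  rw [← integral_add_compl measurableSet_upper₂ (integrable_weak hQ' hF' hφ)]
  have e1 : ∫ q in upper₂, (Q' q * dτ φ q + F' q * dy φ q)
      = ∫ q in upper₂, (Q q * dτ φ q + F q * dy φ q) :=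
    setIntegral_congr_fun measurableSet_upper₂ fun q hq => by
      rw [h1 q hq, h2 q hq]
  have e2 : ∫ q in upper₂ᶜ, (Q' q * dτ φ q + F' q * dy φ q)
      = ∫ q in upper₂ᶜ, g q.1 * dτ φ q :=
    setIntegral_congr_fun measurableSet_upper₂.compl fun q hq => by
      have hq' : q.2 ≤ 0 := not_lt.1 hq
      rw [h3 q hq', h4 q hq', zero_mul, add_zero]
  obtain ⟨B, hB⟩ := hg.2
  rw [e1, e2, integral_lower₂_dτ hφ hg.1 hB, h]

/-! ### Reduction to one space dimension -/

/-- The test function `η(x₁) φ(x₂, t)`. -/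
noncomputable def liftTest (η : ℝ → ℝ) (φ : ℝ × ℝ → ℝ) (z : SpaceTime) : ℝ :=
  η z.1.1 * φ (z.1.2, z.2)

/-- The projection `(x₁, x₂, t) ↦ (x₂, t)`. -/
def proj (z : SpaceTime) : ℝ × ℝ := (z.1.2, z.2)

/-- Reassociating the coordinates exhibits space-time as x₁ times the (x₂, t) half-plane, so that x₁
can be integrated out by Fubini. -/
theorem measurePreserving_upper :
    MeasurePreserving (MeasurableEquiv.prodAssoc : (ℝ × ℝ) × ℝ ≃ᵐ ℝ × (ℝ × ℝ)) upperMeasure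
      ((volume : Measure ℝ).prod (volume.restrict upper₂)) := by
  have h := (volume_preserving_prodAssoc (α₁ := ℝ) (β₁ := ℝ) (γ₁ := ℝ)).restrict_preimage
    (s := univ ×ˢ upper₂) (MeasurableSet.univ.prod measurableSet_upper₂)
  have e1 : (MeasurableEquiv.prodAssoc : (ℝ × ℝ) × ℝ ≃ᵐ ℝ × (ℝ × ℝ)) ⁻¹' (univ ×ˢ upper₂)
      = upper := by
    ext z
    simp [upper, upper₂, MeasurableEquiv.prodAssoc]
  rw [e1, Measure.volume_eq_prod ℝ (ℝ × ℝ), ← Measure.prod_restrict, Measure.restrict_univ] at h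
  exact h

theorem quasiMeasurePreserving_proj :
    Measure.QuasiMeasurePreserving proj upperMeasure (volume.restrict upper₂) :=
  (Measure.quasiMeasurePreserving_snd (μ := (volume : Measure ℝ))
    (ν := volume.restrict upper₂)).comp measurePreserving_upper.quasiMeasurePreserving

theorem fderiv_liftTest {η : ℝ → ℝ} {φ : ℝ × ℝ → ℝ} (hη : Differentiable ℝ η)
    (hφ : Differentiable ℝ φ) (z e : SpaceTime) :
    fderiv ℝ (liftTest η φ) z e =
      η z.1.1 * fderiv ℝ φ (proj z) (proj e) + deriv η z.1.1 * e.1.1 * φ (proj z) := by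
  have h1 : HasFDerivAt (fun z : SpaceTime => η z.1.1)
      ((fderiv ℝ η z.1.1).comp ((ContinuousLinearMap.fst ℝ ℝ ℝ).comp
        (ContinuousLinearMap.fst ℝ (ℝ × ℝ) ℝ))) z :=
    (hη z.1.1).hasFDerivAt.comp z ((ContinuousLinearMap.fst ℝ ℝ ℝ).comp
        (ContinuousLinearMap.fst ℝ (ℝ × ℝ) ℝ)).hasFDerivAt
  have h2 : HasFDerivAt (fun z : SpaceTime => φ (proj z))
      ((fderiv ℝ φ (proj z)).comp (((ContinuousLinearMap.snd ℝ ℝ ℝ).comp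
        (ContinuousLinearMap.fst ℝ (ℝ × ℝ) ℝ)).prod (ContinuousLinearMap.snd ℝ (ℝ × ℝ) ℝ))) z :=
    (hφ (proj z)).hasFDerivAt.comp z (((ContinuousLinearMap.snd ℝ ℝ ℝ).comp
        (ContinuousLinearMap.fst ℝ (ℝ × ℝ) ℝ)).prod
          (ContinuousLinearMap.snd ℝ (ℝ × ℝ) ℝ)).hasFDerivAt
  have h3 : HasFDerivAt (liftTest η φ) _ z := h1.mul h2
  rw [h3.fderiv]
  have h4 : fderiv ℝ η z.1.1 e.1.1 = deriv η z.1.1 * e.1.1 := by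
    rw [← fderiv_apply_one_eq_deriv, mul_comm, ← smul_eq_mul, ← map_smul, smul_eq_mul, mul_one]
  simp only [add_apply, FunLike.coe_smul, Pi.smul_apply,
    ContinuousLinearMap.comp_apply, ContinuousLinearMap.prod_apply, smul_eq_mul,
    ContinuousLinearMap.coe_fst', ContinuousLinearMap.coe_snd', h4]
  simp only [proj]
  ring

section Lift

variable {η : ℝ → ℝ} {φ : ℝ × ℝ → ℝ}

theorem liftTest_isTest (hη : ContDiff ℝ ∞ η) (hηc : HasCompactSupport η) (hφ : IsTest₂ φ) :
    IsTest (liftTest η φ) := by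
  refine ⟨(hη.comp (contDiff_fst.comp contDiff_fst)).mul
    (hφ.1.comp ((contDiff_snd.comp contDiff_fst).prodMk contDiff_snd)), ?_⟩
  obtain ⟨A, hA0, hA⟩ := hasCompactSupport_bound hφ.2
  refine HasCompactSupport.intro (K := (tsupport η ×ˢ Icc (-A) A) ×ˢ Icc (-A) A)
    ((hηc.isCompact.prod isCompact_Icc).prod isCompact_Icc) fun z hz => ?_
  by_contra h0
  have h1 := hA _ (right_ne_zero_of_mul h0)
  rw [abs_le, abs_le] at h1
  exact hz ⟨⟨subset_tsupport η (left_ne_zero_of_mul h0), h1.1⟩, h1.2⟩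

theorem dt_liftTest (hη : Differentiable ℝ η) (hφ : Differentiable ℝ φ) (z : SpaceTime) :
    dt (liftTest η φ) z = η z.1.1 * dτ φ (proj z) := by
  rw [dt, fderiv_liftTest hη hφ]
  simp [proj, dτ]

theorem dx₂_liftTest (hη : Differentiable ℝ η) (hφ : Differentiable ℝ φ) (z : SpaceTime) :
    dx₂ (liftTest η φ) z = η z.1.1 * dy φ (proj z) := by
  rw [dx₂, fderiv_liftTest hη hφ]
  simp [proj, dy]

theorem dx₁_liftTest (hη : Differentiable ℝ η) (hφ : Differentiable ℝ φ) (z : SpaceTime) :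
    dx₁ (liftTest η φ) z = deriv η z.1.1 * φ (proj z) := by
  rw [dx₁, fderiv_liftTest hη hφ]
  have : proj ((1, 0), 0) = 0 := rfl
  simp [this]

/-- Integrating out the variable `x₁`. -/
theorem integral_liftTest (hη : ContDiff ℝ ∞ η) (hηc : HasCompactSupport η) (hη1 : ∫ x, η x = 1)
    (hφ : IsTest₂ φ) {Q P F : ℝ × ℝ → ℝ} (hQ : BddMeas Q) (hP : BddMeas P) (hF : BddMeas F) :
    ∫ z, (Q (proj z) * dt (liftTest η φ) z + P (proj z) * dx₁ (liftTest η φ) z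
      + F (proj z) * dx₂ (liftTest η φ) z) ∂upperMeasure
      = ∫ q in upper₂, (Q q * dτ φ q + F q * dy φ q) := by
  have hηd : Differentiable ℝ η := hη.differentiable (by simp)
  set H : ℝ × (ℝ × ℝ) → ℝ := fun x => η x.1 * (Q x.2 * dτ φ x.2 + F x.2 * dy φ x.2)
    + deriv η x.1 * (P x.2 * φ x.2) with hH
  have e1 : ∀ z, Q (proj z) * dt (liftTest η φ) z + P (proj z) * dx₁ (liftTest η φ) z
      + F (proj z) * dx₂ (liftTest η φ) z = H (MeasurableEquiv.prodAssoc z) := by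
    intro z
    rw [dt_liftTest hηd hφ.differentiable, dx₁_liftTest hηd hφ.differentiable,
      dx₂_liftTest hηd hφ.differentiable]
    have h1 : (MeasurableEquiv.prodAssoc z).1 = z.1.1 := rfl
    have h2 : (MeasurableEquiv.prodAssoc z).2 = proj z := rfl
    simp only [hH, h1, h2]
    ring
  have hηi : Integrable η := hη.continuous.integrable_of_hasCompactSupport hηc
  have hη'i : Integrable (deriv η) :=
    (hη.continuous_deriv (by simp)).integrable_of_hasCompactSupport hηc.deriv
  simp only [e1]
  rw [measurePreserving_upper.integral_comp MeasurableEquiv.prodAssoc.measurableEmbedding H, hH,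
    integral_add]
  -- The x₁-flux drops out since η' integrates to zero.
  · rw [integral_prod_mul η (fun q => Q q * dτ φ q + F q * dy φ q),
      integral_prod_mul (deriv η) (fun q => P q * φ q), hη1,
      integral_eq_zero_of_hasDerivAt_of_integrable (fun x => (hηd x).hasDerivAt) hη'i hηi]
    ring
  · exact hηi.mul_prod (integrable_weak hQ hF hφ).restrict
  · exact hη'i.mul_prod (hP.integrable_mul hφ.continuous hφ.2).restrict

theorem integral_liftTest_initial (hη1 : ∫ x, η x = 1) (g : ℝ → ℝ) :
    ∫ x : Plane, g x.2 * liftTest η φ (x, 0) = ∫ y, g y * φ (y, 0) := by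
  have : ∀ x : Plane, g x.2 * liftTest η φ (x, 0) = η x.1 * (g x.2 * φ (x.2, 0)) := by
    intro x
    simp only [liftTest]
    ring
  simp only [this]
  rw [Measure.volume_eq_prod, integral_prod_mul η (fun y => g y * φ (y, 0)), hη1, one_mul]

end Lift

theorem exists_unit_mass :
    ∃ η : ℝ → ℝ, ContDiff ℝ ∞ η ∧ HasCompactSupport η ∧ ∫ x, η x = 1 ∧ ∀ x, 0 ≤ η x := by
  let b : ContDiffBump (0 : ℝ) := ⟨1, 2, one_pos, one_lt_two⟩
  exact ⟨b.normed volume, b.contDiff_normed, b.hasCompactSupport_normed, b.integral_normed,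
    fun x => b.nonneg_normed x⟩

theorem exists_ae_bound {f : SpaceTime → ℝ} (h : MemLp f ⊤ upperMeasure) :
    ∃ B, ∀ᵐ z ∂upperMeasure, |f z| ≤ B := by
  have h2 := h.2
  rw [eLpNorm_exponent_top] at h2
  refine ⟨(eLpNormEssSup f upperMeasure).toReal, ?_⟩
  filter_upwards [ae_le_eLpNormEssSup (f := f) (μ := upperMeasure)] with z hz
  have := ENNReal.toReal_mono h2.ne hz
  rwa [toReal_enorm] at this

/-- A function of one-dimensional symmetry has a measurable representative on the plane. -/
theorem exists_representative {f : SpaceTime → ℝ} {W : ℝ × ℝ → ℝ}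
    (hf : AEStronglyMeasurable f upperMeasure) (hW : ∀ᵐ z ∂upperMeasure, f z = W (proj z))
    {a b : ℝ} (hab : a ≤ b) (hb : ∀ᵐ z ∂upperMeasure, a ≤ f z ∧ f z ≤ b) :
    ∃ g : ℝ × ℝ → ℝ, Measurable g ∧ (∀ q, a ≤ g q ∧ g q ≤ b) ∧
      ∀ᵐ z ∂upperMeasure, f z = g (proj z) := by
  obtain ⟨R, hRm, hR⟩ := hf
  have h1 : ∀ᵐ z ∂upperMeasure, R z = W (proj z) := by
    filter_upwards [hR, hW] with z e1 e2
    rw [← e1, e2]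
  have h2 : ∀ᵐ x ∂((volume : Measure ℝ).prod (volume.restrict upper₂)),
      R (MeasurableEquiv.prodAssoc.symm x) = W x.2 := by
    exact (measurePreserving_upper.symm _).quasiMeasurePreserving.ae h1
  -- The profile W is not assumed measurable. Freezing x₁ at a generic value in a measurable version
  -- of f gives a measurable function that agrees with W almost everywhere; it is then clamped to
  -- [a, b].
  obtain ⟨x, hx⟩ := (Measure.ae_ae_of_ae_prod h2).exists
  set g₀ : ℝ × ℝ → ℝ := fun q => R ((x, q.1), q.2) with hg₀
  have hg₀m : Measurable g₀ := hRm.measurable.comp (by fun_prop)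
  have h3 : ∀ᵐ z ∂upperMeasure, g₀ (proj z) = W (proj z) :=
    quasiMeasurePreserving_proj.ae hx
  refine ⟨fun q => max a (min b (g₀ q)), measurable_const.max (measurable_const.min hg₀m),
    fun q => ⟨le_max_left _ _, max_le hab (min_le_left _ _)⟩, ?_⟩
  filter_upwards [hW, h3, hb] with z e1 e2 e3
  rw [e2, ← e1, min_eq_right e3.2, max_eq_right e3.1]

/-- Bounded solutions on the half-plane `t > 0` of the system for functions of `(x₂, t)`, with
density bounded below and Riemann initial data. -/
structure IsPlanarSolution (p ε : ℝ → ℝ) (sL sR : State) (c M : ℝ) (r w v : ℝ × ℝ → ℝ) :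
    Prop where
  c_pos : 0 < c
  measurable_r : Measurable r
  le_r : ∀ q, c ≤ r q
  r_le : ∀ q, r q ≤ M
  measurable_w : Measurable w
  abs_w_le : ∀ q, |w q| ≤ M
  measurable_v : Measurable v
  abs_v_le : ∀ q, |v q| ≤ M
  mass : ∀ φ, IsTest₂ φ → (∫ q in upper₂, (r q * dτ φ q + r q * v q * dy φ q))
    + ∫ y, (riemannData sL sR (0, y)).ρ * φ (y, 0) = 0
  momentum₁ : ∀ φ, IsTest₂ φ → (∫ q in upper₂, (r q * w q * dτ φ q + r q * w q * v q * dy φ q))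
    + ∫ y, (riemannData sL sR (0, y)).ρ * (riemannData sL sR (0, y)).v₁ * φ (y, 0) = 0
  momentum₂ : ∀ φ, IsTest₂ φ →
    (∫ q in upper₂, (r q * v q * dτ φ q + (r q * v q * v q + p (r q)) * dy φ q))
    + ∫ y, (riemannData sL sR (0, y)).ρ * (riemannData sL sR (0, y)).v₂ * φ (y, 0) = 0
  entropy : ∀ φ, IsTest₂ φ → (∀ q, 0 ≤ φ q) →
    0 ≤ (∫ q in upper₂, (energy ε ⟨r q, w q, v q⟩ * dτ φ q
      + (energy ε ⟨r q, w q, v q⟩ + p (r q)) * v q * dy φ q))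
    + ∫ y, energy ε (riemannData sL sR (0, y)) * φ (y, 0)

theorem IsPressureLaw.continuousOn {p : ℝ → ℝ} (hp : IsPressureLaw p) : ContinuousOn p (Ioi 0) :=
  fun y hy => (hp y hy).2.1.continuousAt.continuousWithinAt

theorem IsInternalEnergy.continuousOn {p ε : ℝ → ℝ} (hε : IsInternalEnergy p ε) :
    ContinuousOn ε (Ioi 0) :=
  fun y hy => (hε y hy).1.continuousAt.continuousWithinAt

/-- One-dimensional admissible solutions reduce to solutions on the half-plane. -/
theorem exists_planarSolution {p ε : ℝ → ℝ} (hp : IsPressureLaw p) (hε : IsInternalEnergy p ε)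
    {sL sR : State} (hρ : 0 < sL.ρ) {U : SpaceTime → State}
    (hU : IsAdmissibleWeakSolution p ε (riemannData sL sR) U)
    (hU_one : IsOneDimensional U) (hU_inf : DensityBoundedBelow U) :
    ∃ c M r w v, IsPlanarSolution p ε sL sR c M r w v ∧ c ≤ sL.ρ ∧ sL.ρ ≤ M ∧
      ∀ᵐ z ∂upperMeasure, U z = ⟨r (proj z), w (proj z), v (proj z)⟩ := by
  obtain ⟨W, hW⟩ := hU_one
  obtain ⟨c₀, hc₀, hcU⟩ := hU_inf
  obtain ⟨b1, b2, b3⟩ := hU.bounded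
  obtain ⟨B1, hB1⟩ := exists_ae_bound b1
  obtain ⟨B2, hB2⟩ := exists_ae_bound b2
  obtain ⟨B3, hB3⟩ := exists_ae_bound b3
  -- The initial density is included in both bounds, so that they persist after extension to t ≤ 0.
  set c := min c₀ sL.ρ with hc
  set M := max (max B1 sL.ρ) (max B2 B3) with hM
  have hcpos : 0 < c := lt_min hc₀ hρ
  have hM1 : B1 ≤ M := (le_max_left _ _).trans (le_max_left _ _)
  have hMρ : sL.ρ ≤ M := (le_max_right _ _).trans (le_max_left _ _)
  have hM2 : B2 ≤ M := (le_max_left _ _).trans (le_max_right _ _)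
  have hM3 : B3 ≤ M := (le_max_right _ _).trans (le_max_right _ _)
  have hcM : c ≤ M := (min_le_right _ _).trans hMρ
  have hM0 : -M ≤ M := by linarith
  obtain ⟨r, hrm, hrb, hr⟩ := exists_representative (f := fun z => (U z).ρ)
    (W := fun q => (W q.1 q.2).ρ) b1.1 (hW.mono fun z hz => by rw [hz]; rfl) hcM (by
      filter_upwards [hB1, hcU] with z e1 e2
      exact ⟨(min_le_left _ _).trans e2, (le_abs_self _).trans (e1.trans hM1)⟩)
  obtain ⟨w, hwm, hwb, hw⟩ := exists_representative (f := fun z => (U z).v₁)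
    (W := fun q => (W q.1 q.2).v₁) b2.1 (hW.mono fun z hz => by rw [hz]; rfl) hM0 (by
      filter_upwards [hB2] with z e1
      exact abs_le.1 (e1.trans hM2))
  obtain ⟨v, hvm, hvb, hv⟩ := exists_representative (f := fun z => (U z).v₂)
    (W := fun q => (W q.1 q.2).v₂) b3.1 (hW.mono fun z hz => by rw [hz]; rfl) hM0 (by
      filter_upwards [hB3] with z e1
      exact abs_le.1 (e1.trans hM3))
  have hrep : ∀ᵐ z ∂upperMeasure, U z = ⟨r (proj z), w (proj z), v (proj z)⟩ := by
    filter_upwards [hr, hw, hv] with z e1 e2 e3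
    rw [← e1, ← e2, ← e3]
  have mr : BddMeas r := ⟨hrm, M, fun q =>
    abs_le.2 ⟨by linarith [(hrb q).1], (hrb q).2⟩⟩
  have mw : BddMeas w := ⟨hwm, M, fun q => abs_le.2 (hwb q)⟩
  have mv : BddMeas v := ⟨hvm, M, fun q => abs_le.2 (hvb q)⟩
  have mp : BddMeas fun q => p (r q) :=
    BddMeas.comp_continuousOn hp.continuousOn hcpos hrm (fun q => (hrb q).1) fun q => (hrb q).2
  have mε : BddMeas fun q => ε (r q) :=
    BddMeas.comp_continuousOn hε.continuousOn hcpos hrm (fun q => (hrb q).1) fun q => (hrb q).2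
  have me : BddMeas fun q => energy ε ⟨r q, w q, v q⟩ :=
    (mr.mul mε).add (mr.mul ((mw.sq.add mv.sq).div_const 2))
  obtain ⟨η, hη, hηc, hη1, hη0⟩ := exists_unit_mass
  refine ⟨c, M, r, w, v, ⟨hcpos, hrm, fun q => (hrb q).1, fun q => (hrb q).2, hwm,
    fun q => abs_le.2 (hwb q), hvm, fun q => abs_le.2 (hvb q), fun φ hφ => ?_, fun φ hφ => ?_,
    fun φ hφ => ?_, fun φ hφ hφ0 => ?_⟩, min_le_right _ _, hMρ, hrep⟩
  · have h := hU.mass _ (liftTest_isTest hη hηc hφ)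
    rw [← integral_liftTest hη hηc hη1 hφ mr (mr.mul mw) (mr.mul mv),
      ← integral_liftTest_initial hη1 (fun y => (riemannData sL sR (0, y)).ρ)]
    refine Eq.trans ?_ h
    congr 1
    refine integral_congr_ae ?_
    filter_upwards [hrep] with z hz
    rw [hz]
    ring
  · have h := hU.momentum₁ _ (liftTest_isTest hη hηc hφ)
    rw [← integral_liftTest hη hηc hη1 hφ (mr.mul mw) (((mr.mul mw).mul mw).add mp)
      ((mr.mul mw).mul mv), ← integral_liftTest_initial hη1
        (fun y => (riemannData sL sR (0, y)).ρ * (riemannData sL sR (0, y)).v₁)]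
    refine Eq.trans ?_ h
    congr 1
    refine integral_congr_ae ?_
    filter_upwards [hrep] with z hz
    rw [hz]
    ring
  · have h := hU.momentum₂ _ (liftTest_isTest hη hηc hφ)
    rw [← integral_liftTest hη hηc hη1 hφ (mr.mul mv) ((mr.mul mv).mul mw)
      (((mr.mul mv).mul mv).add mp), ← integral_liftTest_initial hη1
        (fun y => (riemannData sL sR (0, y)).ρ * (riemannData sL sR (0, y)).v₂)]
    refine Eq.trans ?_ h
    congr 1
    refine integral_congr_ae ?_
    filter_upwards [hrep] with z hz
    rw [hz]
    ring
  · have h := hU.entropy _ (liftTest_isTest hη hηc hφ)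
      (fun z _ => mul_nonneg (hη0 _) (hφ0 _))
    rw [← integral_liftTest hη hηc hη1 hφ me ((me.add mp).mul mw) ((me.add mp).mul mv),
      ← integral_liftTest_initial hη1 (fun y => energy ε (riemannData sL sR (0, y)))]
    refine h.trans_eq ?_
    congr 1
    refine integral_congr_ae ?_
    filter_upwards [hrep] with z hz
    rw [hz]
    ring

/-! ### The tangential velocity of a planar solution -/

namespace IsPlanarSolution

variable {p ε : ℝ → ℝ} {sL sR : State} {c M : ℝ} {r w v : ℝ × ℝ → ℝ}

theorem bddMeas_r (h : IsPlanarSolution p ε sL sR c M r w v) : BddMeas r :=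
  ⟨h.measurable_r, M, fun q => abs_le.2
    ⟨by linarith [h.c_pos, h.le_r q, h.r_le q], h.r_le q⟩⟩

theorem bddMeas_w (h : IsPlanarSolution p ε sL sR c M r w v) : BddMeas w :=
  ⟨h.measurable_w, M, h.abs_w_le⟩

theorem bddMeas_v (h : IsPlanarSolution p ε sL sR c M r w v) : BddMeas v :=
  ⟨h.measurable_v, M, h.abs_v_le⟩

/-- Only almost everywhere, because the two conventions at y = 0 differ. -/
theorem ae_initial_v₁ (sL sR : State) :
    ∀ᵐ y : ℝ, (riemannData sL sR (0, y)).v₁ = jump sL.v₁ sR.v₁ y := by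
  have : ∀ᵐ y : ℝ, y ≠ 0 := by simp [ae_iff]
  filter_upwards [this] with y hy
  rcases lt_or_gt_of_ne hy with h | h
  · simp [riemannData, jump, h, h.le]
  · simp [riemannData, jump, not_lt.2 h.le, not_le.2 h]

theorem initial_ρ (hρ : sR.ρ = sL.ρ) (y : ℝ) : (riemannData sL sR (0, y)).ρ = sL.ρ := by
  unfold riemannData
  split_ifs
  · rfl
  · exact hρ

theorem initial_v₂ (hv : sR.v₂ = sL.v₂) (y : ℝ) : (riemannData sL sR (0, y)).v₂ = sL.v₂ := by
  unfold riemannData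
  split_ifs
  · rfl
  · exact hv

/-- The momentum, extended by `0` to `t ≤ 0`. -/
noncomputable def extMomentum (r v : ℝ × ℝ → ℝ) (q : ℝ × ℝ) : ℝ :=
  upper₂.indicator (fun q => r q * v q) q

/-- The tangential velocity is a step function of the mass coordinate. -/
theorem ae_w_eq (h : IsPlanarSolution p ε sL sR c M r w v) (hρ : sR.ρ = sL.ρ)
    (hc : c ≤ sL.ρ) (hM : sL.ρ ≤ M) :
    ∀ᵐ q ∂(volume.restrict upper₂),
      w q = jump sL.v₁ sR.v₁ (massCoord sL.ρ (extMomentum r v) q) := by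
  classical
  have hMpos : 0 < M := h.c_pos.trans_le (hc.trans hM)
  set r' : ℝ × ℝ → ℝ := upper₂.piecewise r fun _ => sL.ρ with hr'
  set w' : ℝ × ℝ → ℝ := upper₂.piecewise w fun q => jump sL.v₁ sR.v₁ q.1 with hw'
  have hup : ∀ q : ℝ × ℝ, q.2 ≤ 0 → q ∉ upper₂ := fun q hq => not_lt.2 hq
  have r'm : Measurable r' := h.measurable_r.piecewise measurableSet_upper₂ measurable_const
  have hr1 : ∀ q, c ≤ r' q := by
    intro q
    by_cases hq : q ∈ upper₂
    · simp only [hr', piecewise_eq_of_mem _ _ _ hq, h.le_r q]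
    · simp only [hr', piecewise_eq_of_notMem _ _ _ hq, hc]
  have hr2 : ∀ q, r' q ≤ M := by
    intro q
    by_cases hq : q ∈ upper₂
    · simp only [hr', piecewise_eq_of_mem _ _ _ hq, h.r_le q]
    · simp only [hr', piecewise_eq_of_notMem _ _ _ hq, hM]
  have mr' : BddMeas r' := ⟨r'm, M, fun q => abs_le.2
    ⟨by linarith [h.c_pos, hr1 q], hr2 q⟩⟩
  have hrv : ∀ q, |r q * v q| ≤ M * M := by
    intro q
    rw [abs_mul]
    refine mul_le_mul (abs_le.2 ⟨?_, h.r_le q⟩) (h.abs_v_le q) (abs_nonneg _) hMpos.le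
    linarith [h.c_pos, h.le_r q]
  have hmB : ∀ q, |extMomentum r v q| ≤ M * M := by
    intro q
    by_cases hq : q ∈ upper₂
    · rw [extMomentum, indicator_of_mem hq]; exact hrv q
    · rw [extMomentum, indicator_of_notMem hq, abs_zero]; positivity
  have mm : BddMeas (extMomentum r v) :=
    ⟨(h.measurable_r.mul h.measurable_v).indicator measurableSet_upper₂, M * M, hmB⟩
  -- One constant has to bound both the density, by M, and the momentum, by M².
  have hpair : IsMassPair c (M + M * M) sL.ρ r' (extMomentum r v) := by
    refine ⟨h.c_pos, r'm, mm.1, hr1, fun q => (hr2 q).trans (by nlinarith),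
      fun q => (hmB q).trans (by linarith), fun q hq => ?_, fun q hq => ?_, fun φ hφ => ?_⟩
    · simp only [hr', piecewise_eq_of_notMem _ _ _ (hup q hq)]
    · simp only [extMomentum, indicator_of_notMem (hup q hq)]
    · have hm := h.mass φ hφ
      simp only [initial_ρ hρ] at hm
      refine integral_extend (BddMeas.const sL.ρ) hφ hm mr' mm (fun q hq => ?_)
        (fun q hq => ?_) (fun q hq => ?_) fun q hq => ?_
      · simp only [hr', piecewise_eq_of_mem _ _ _ hq]
      · simp only [extMomentum, indicator_of_mem hq]
      · simp only [hr', piecewise_eq_of_notMem _ _ _ (hup q hq)]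
      · simp only [extMomentum, indicator_of_notMem (hup q hq)]
  have w'm : Measurable w' := h.measurable_w.piecewise measurableSet_upper₂
    ((measurable_jump _ _).comp measurable_fst)
  have w'B : ∀ q, |w' q| ≤ M + (|sL.v₁| + |sR.v₁|) := by
    intro q
    by_cases hq : q ∈ upper₂
    · simp only [hw', piecewise_eq_of_mem _ _ _ hq]
      linarith [h.abs_w_le q, abs_nonneg sL.v₁, abs_nonneg sR.v₁]
    · simp only [hw', piecewise_eq_of_notMem _ _ _ hq]
      linarith [abs_jump_le sL.v₁ sR.v₁ q.1]
  have mw' : BddMeas w' := ⟨w'm, _, w'B⟩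
  have hT : IsTransported r' (extMomentum r v) w' := by
    intro φ hφ
    have hm := h.momentum₁ φ hφ
    simp only [initial_ρ hρ] at hm
    have e0 : ∫ y, sL.ρ * (riemannData sL sR (0, y)).v₁ * φ (y, 0)
        = ∫ y, sL.ρ * jump sL.v₁ sR.v₁ y * φ (y, 0) := by
      refine integral_congr_ae ?_
      filter_upwards [ae_initial_v₁ sL sR] with y hy
      rw [hy]
    rw [e0] at hm
    have mj : BddMeas fun y => sL.ρ * jump sL.v₁ sR.v₁ y :=
      (BddMeas.const sL.ρ).mul ⟨measurable_jump _ _, _, abs_jump_le _ _⟩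
    have key := integral_extend mj hφ hm (mr'.mul mw') (mm.mul mw')
      (fun q hq => ?_) (fun q hq => ?_) (fun q hq => ?_) (fun q hq => ?_)
    · rw [← key]
      congr 1
      ext q
      ring
    · simp only [hr', hw', piecewise_eq_of_mem _ _ _ hq]
    · simp only [extMomentum, indicator_of_mem hq, hw', piecewise_eq_of_mem _ _ _ hq]
      ring
    · simp only [hr', hw', piecewise_eq_of_notMem _ _ _ (hup q hq)]
    · simp only [extMomentum, indicator_of_notMem (hup q hq), zero_mul]
  have key := hpair.ae_eq_jump w'm w'B hT (a := sL.v₁) (b := sR.v₁) fun q hq => by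
    simp only [hw', piecewise_eq_of_notMem _ _ _ (hup q hq)]
  filter_upwards [ae_restrict_of_ae key, ae_restrict_mem measurableSet_upper₂] with q h1 hq
  rw [← h1]
  simp only [hw', piecewise_eq_of_mem _ _ _ hq]

/-! ### Constancy of density and normal velocity -/

/-- The relative energy with respect to the constant density `ρ₀` and normal velocity `V`. -/
noncomputable def relE (p ε : ℝ → ℝ) (ρ₀ V : ℝ) (r v : ℝ × ℝ → ℝ) (q : ℝ × ℝ) : ℝ :=
  relEnergy p ε ρ₀ (r q) + r q * (v q - V) ^ 2 / 2

/-- The flux of the relative energy. -/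
noncomputable def relQ (p ε : ℝ → ℝ) (ρ₀ V : ℝ) (r v : ℝ × ℝ → ℝ) (q : ℝ × ℝ) : ℝ :=
  v q * relE p ε ρ₀ V r v q + (p (r q) - p ρ₀) * (v q - V)

/-- The relative energy and its flux are the energy and its flux plus a combination of conserved
quantities and constants. Two-valuedness of w is what makes rw²/2 one of the removable terms. No
initial term remains, as the same combination vanishes on both data states. -/
theorem relE_inequality (hp : IsPressureLaw p) (hε : IsInternalEnergy p ε)
    (h : IsPlanarSolution p ε sL sR c M r w v) (hρ : sR.ρ = sL.ρ) (hρ0 : 0 < sL.ρ)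
    (hv₂ : sR.v₂ = sL.v₂)
    (hw : ∀ᵐ q ∂(volume.restrict upper₂), w q = sL.v₁ ∨ w q = sR.v₁)
    {φ : ℝ × ℝ → ℝ} (hφ : IsTest₂ φ) (hφ0 : ∀ q, 0 ≤ φ q) :
    0 ≤ ∫ q in upper₂, (relE p ε sL.ρ sL.v₂ r v q * dτ φ q
      + relQ p ε sL.ρ sL.v₂ r v q * dy φ q) := by
  have mr := h.bddMeas_r
  have mw := h.bddMeas_w
  have mv := h.bddMeas_v
  have mp : BddMeas fun q => p (r q) :=
    BddMeas.comp_continuousOn hp.continuousOn h.c_pos h.measurable_r h.le_r h.r_le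
  have mε : BddMeas fun q => ε (r q) :=
    BddMeas.comp_continuousOn hε.continuousOn h.c_pos h.measurable_r h.le_r h.r_le
  have me : BddMeas fun q => energy ε ⟨r q, w q, v q⟩ :=
    (mr.mul mε).add (mr.mul ((mw.sq.add mv.sq).div_const 2))
  set a := sL.v₁
  set b := sR.v₁
  set V := sL.v₂
  set ρ₀ := sL.ρ
  have i1 := (integrable_weak me ((me.add mp).mul mv) hφ).integrableOn (s := upper₂)
  have i2 := (integrable_weak (mr.mul mw) ((mr.mul mw).mul mv) hφ).integrableOn (s := upper₂)
  have i3 := (integrable_weak mr (mr.mul mv) hφ).integrableOn (s := upper₂)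
  have i4 := (integrable_weak (mr.mul mv) (((mr.mul mv).mul mv).add mp) hφ).integrableOn
    (s := upper₂)
  have i5 := (integrable_weak (BddMeas.const 1) (BddMeas.const V) hφ).integrableOn (s := upper₂)
  have n1 := h.entropy φ hφ hφ0
  have n2 := h.momentum₁ φ hφ
  have n3 := h.mass φ hφ
  have n4 := h.momentum₂ φ hφ
  have n5 : (∫ q in upper₂, (1 * dτ φ q + V * dy φ q)) + ∫ y, 1 * φ (y, 0) = 0 := by
    have e1 := integral_upper₂_dτ hφ (g := fun _ => 1) (M := 1) measurable_const (by simp)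
    have e2 := integral_upper₂_dy hφ
    rw [integral_add, e1, integral_const_mul V, e2]
    · ring
    · exact ((hφ.dτ.continuous.integrable_of_hasCompactSupport hφ.dτ.2).const_mul 1).integrableOn
    · exact ((hφ.dy.continuous.integrable_of_hasCompactSupport hφ.dy.2).const_mul V).integrableOn
  -- With w² = (a + b)w - ab, α and the ab/2 in β cancel rw²/2. The rest of β, together with the
  -- multipliers -V and p(ρ₀), subtracts the affine part of the energy at (ρ₀, V).
  set α := -(a + b) / 2 with hα
  set β := a * b / 2 - ε ρ₀ - p ρ₀ / ρ₀ + V ^ 2 / 2 with hβ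
  have split : ∫ q in upper₂, (relE p ε ρ₀ V r v q * dτ φ q + relQ p ε ρ₀ V r v q * dy φ q)
      = (∫ q in upper₂, (energy ε ⟨r q, w q, v q⟩ * dτ φ q
          + (energy ε ⟨r q, w q, v q⟩ + p (r q)) * v q * dy φ q))
        + α * (∫ q in upper₂, (r q * w q * dτ φ q + r q * w q * v q * dy φ q))
        + β * (∫ q in upper₂, (r q * dτ φ q + r q * v q * dy φ q))
        + (-V) * (∫ q in upper₂, (r q * v q * dτ φ q + (r q * v q * v q + p (r q)) * dy φ q))
        + p ρ₀ * (∫ q in upper₂, (1 * dτ φ q + V * dy φ q)) := by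
    rw [← integral_linear_combination i1 i2 i3 i4 i5]
    refine integral_congr_ae ?_
    filter_upwards [hw] with q hq
    have hww : w q ^ 2 = (a + b) * w q - a * b := by
      rcases hq with hq | hq <;> rw [hq] <;> ring
    have hE : relE p ε ρ₀ V r v q = energy ε ⟨r q, w q, v q⟩ + α * (r q * w q) + β * r q
        + (-V) * (r q * v q) + p ρ₀ := by
      simp only [relE, relEnergy, energy, hww, hα, hβ]
      field_simp
      ring
    simp only [relQ, hE]
    ring
  have hbr : ∀ y, energy ε (riemannData sL sR (0, y))
      + α * ((riemannData sL sR (0, y)).ρ * (riemannData sL sR (0, y)).v₁)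
      + β * (riemannData sL sR (0, y)).ρ
      + (-V) * ((riemannData sL sR (0, y)).ρ * (riemannData sL sR (0, y)).v₂) + p ρ₀ = 0 := by
    intro y
    have hw0 : (riemannData sL sR (0, y)).v₁ = a ∨ (riemannData sL sR (0, y)).v₁ = b := by
      unfold riemannData
      split_ifs
      · exact .inl rfl
      · exact .inr rfl
    have hww : (riemannData sL sR (0, y)).v₁ ^ 2
        = (a + b) * (riemannData sL sR (0, y)).v₁ - a * b := by
      rcases hw0 with hq | hq <;> rw [hq] <;> ring
    simp only [energy, hww, initial_ρ hρ, initial_v₂ hv₂, hα, hβ]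
    change ρ₀ * ε ρ₀ + _ + _ + _ + _ + _ = 0
    field_simp
    ring
  have hfin : ∀ g : State → ℝ, Integrable fun y => g (riemannData sL sR (0, y)) * φ (y, 0) := by
    intro g
    refine BddMeas.integrable_mul ⟨?_, |g sL| + |g sR|, fun y => ?_⟩
      (hφ.continuous.comp (by fun_prop)) (hasCompactSupport_slice_fst hφ.2 0)
    · simp only [riemannData, apply_ite g]
      exact Measurable.ite measurableSet_Iio measurable_const measurable_const
    · change |g (riemannData sL sR (0, y))| ≤ _
      unfold riemannData
      split_ifs
      · linarith [abs_nonneg (g sR)]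
      · linarith [abs_nonneg (g sL)]
  have l1 := hfin (energy ε)
  have l2 := hfin fun s => s.ρ * s.v₁
  have l3 := hfin fun s => s.ρ
  have l4 := hfin fun s => s.ρ * s.v₂
  have l5 := hfin fun _ => 1
  have hinit : (∫ y, energy ε (riemannData sL sR (0, y)) * φ (y, 0))
      + α * (∫ y, (riemannData sL sR (0, y)).ρ * (riemannData sL sR (0, y)).v₁ * φ (y, 0))
      + β * (∫ y, (riemannData sL sR (0, y)).ρ * φ (y, 0))
      + (-V) * (∫ y, (riemannData sL sR (0, y)).ρ * (riemannData sL sR (0, y)).v₂ * φ (y, 0))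
      + p ρ₀ * (∫ y, 1 * φ (y, 0)) = 0 := by
    rw [← integral_linear_combination l1 l2 l3 l4 l5]
    refine integral_eq_zero_of_ae (.of_forall fun y => ?_)
    simp only [Pi.zero_apply]
    linear_combination φ (y, 0) * hbr y
  rw [split]
  -- Only the energy balance is an inequality and it enters with coefficient 1; the others are
  -- equalities, so their multipliers may have any sign.
  linear_combination n1 - α * n2 - β * n3 + V * n4 - p ρ₀ * n5 + hinit

/-- Density and normal velocity are constant. -/
theorem ae_r_v_eq (hp : IsPressureLaw p) (hε : IsInternalEnergy p ε)
    (h : IsPlanarSolution p ε sL sR c M r w v) (hρ : sR.ρ = sL.ρ) (hc : c ≤ sL.ρ)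
    (hM : sL.ρ ≤ M) (hv₂ : sR.v₂ = sL.v₂)
    (hw : ∀ᵐ q ∂(volume.restrict upper₂), w q = sL.v₁ ∨ w q = sR.v₁) :
    ∀ᵐ q ∂(volume.restrict upper₂), r q = sL.ρ ∧ v q = sL.v₂ := by
  have hρ0 : 0 < sL.ρ := h.c_pos.trans_le hc
  have hM0 : 0 < M := hρ0.trans_le hM
  obtain ⟨C, k, hC, hk, hb⟩ := exists_relEnergy_bound hp hε h.c_pos hc hM
  have mr := h.bddMeas_r
  have mv := h.bddMeas_v
  have mp : BddMeas fun q => p (r q) :=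
    BddMeas.comp_continuousOn hp.continuousOn h.c_pos h.measurable_r h.le_r h.r_le
  have mε : BddMeas fun q => ε (r q) :=
    BddMeas.comp_continuousOn hε.continuousOn h.c_pos h.measurable_r h.le_r h.r_le
  have mE : BddMeas (relE p ε sL.ρ sL.v₂ r v) :=
    (((mr.mul mε).sub (mr.mul (.const _))).sub
      (((BddMeas.const _).mul (mr.sub (.const _))).div_const _)).add
      ((mr.mul (mv.sub (.const _)).sq).div_const 2)
  have mQ : BddMeas (relQ p ε sL.ρ sL.v₂ r v) :=
    (mv.mul mE).add ((mp.sub (.const _)).mul (mv.sub (.const _)))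
  have hR0 : ∀ q, 0 ≤ relEnergy p ε sL.ρ (r q) := fun q =>
    (mul_nonneg hk.le (sq_nonneg _)).trans (hb _ (h.le_r q) (h.r_le q)).1
  have hr0 : ∀ q, 0 < r q := fun q => h.c_pos.trans_le (h.le_r q)
  have hK0 : ∀ q, 0 ≤ r q * (v q - sL.v₂) ^ 2 / 2 := fun q => by
    have := hr0 q
    positivity
  have hE0 : ∀ q, 0 ≤ relE p ε sL.ρ sL.v₂ r v q := fun q => add_nonneg (hR0 q) (hK0 q)
  -- M bounds the transport part vE. The product (p - p(ρ₀))(v - V) is split by Young's inequality,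
  -- with C controlling the pressure square and 1/c turning (v - V)²/2 into r(v - V)²/2.
  have hQE : ∀ q, |relQ p ε sL.ρ sL.v₂ r v q| ≤ (M + (C + 1 / c)) * relE p ε sL.ρ sL.v₂ r v q := by
    intro q
    have e1 : |v q * relE p ε sL.ρ sL.v₂ r v q| ≤ M * relE p ε sL.ρ sL.v₂ r v q := by
      rw [abs_mul, abs_of_nonneg (hE0 q)]
      exact mul_le_mul_of_nonneg_right (h.abs_v_le q) (hE0 q)
    have e2 : |(p (r q) - p sL.ρ) * (v q - sL.v₂)|
        ≤ (p (r q) - p sL.ρ) ^ 2 / 2 + (v q - sL.v₂) ^ 2 / 2 := by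
      rw [abs_le]
      constructor
      · nlinarith [sq_nonneg (p (r q) - p sL.ρ + (v q - sL.v₂))]
      · nlinarith [sq_nonneg (p (r q) - p sL.ρ - (v q - sL.v₂))]
    have e3 := (hb _ (h.le_r q) (h.r_le q)).2
    have e4 : (v q - sL.v₂) ^ 2 / 2 ≤ 1 / c * (r q * (v q - sL.v₂) ^ 2 / 2) := by
      rw [div_mul_eq_mul_div, le_div_iff₀ h.c_pos, one_mul]
      have := mul_le_mul_of_nonneg_right (h.le_r q) (sq_nonneg (v q - sL.v₂))
      linarith
    have hc1 : 0 ≤ 1 / c := by have := h.c_pos; positivity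
    have e5 := mul_nonneg hC (hK0 q)
    have e6 := mul_nonneg hc1 (hR0 q)
    have e7 := mul_nonneg hC (hR0 q)
    have e8 : (C + 1 / c) * relE p ε sL.ρ sL.v₂ r v q
        = C * relEnergy p ε sL.ρ (r q) + C * (r q * (v q - sL.v₂) ^ 2 / 2)
          + 1 / c * relEnergy p ε sL.ρ (r q) + 1 / c * (r q * (v q - sL.v₂) ^ 2 / 2) := by
      simp only [relE]
      ring
    rw [add_mul, e8]
    refine (abs_add_le _ _).trans (add_le_add e1 ?_)
    linarith
  obtain ⟨B, hB⟩ := mE.2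
  have key := ae_eq_zero_of_finite_speed mE.1 mQ.1 hB hQE
    (by have := h.c_pos; positivity) hE0
    fun φ hφ hφ0 => h.relE_inequality hp hε hρ hρ0 hv₂ hw hφ hφ0
  filter_upwards [key] with q hq
  have h1 : relEnergy p ε sL.ρ (r q) = 0 := by
    have := hR0 q
    have := hK0 q
    simp only [relE] at hq
    linarith
  have h2 : r q * (v q - sL.v₂) ^ 2 / 2 = 0 := by
    simp only [relE] at hq
    linarith
  have h3 := (hb _ (h.le_r q) (h.r_le q)).1
  rw [h1] at h3
  have h4 : (r q - sL.ρ) ^ 2 ≤ 0 := by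
    by_contra! hlt
    exact absurd h3 (not_le.2 (mul_pos hk hlt))
  refine ⟨sub_eq_zero.1 (pow_eq_zero_iff two_ne_zero |>.1 (le_antisymm h4 (sq_nonneg _))), ?_⟩
  have h5 : (v q - sL.v₂) ^ 2 = 0 := by
    have := hr0 q
    rcases mul_eq_zero.1 ((div_eq_zero_iff.1 h2).resolve_right two_ne_zero) with h6 | h6
    · exact absurd h6 this.ne'
    · exact h6
  exact sub_eq_zero.1 (pow_eq_zero_iff two_ne_zero |>.1 h5)

/-- The mass coordinate of a flow of constant density and velocity. -/
theorem ae_massCoord_eq {ρ₀ V : ℝ}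
    (hrv : ∀ᵐ q ∂(volume.restrict upper₂), r q = ρ₀ ∧ v q = V) :
    ∀ᵐ q ∂(volume.restrict upper₂),
      massCoord ρ₀ (extMomentum r v) q = ρ₀ * (q.1 - V * q.2) := by
  rw [ae_restrict_iff' measurableSet_upper₂] at hrv
  have h1 : ∀ᵐ y : ℝ, ∀ᵐ s : ℝ, (y, s) ∈ upper₂ → r (y, s) = ρ₀ ∧ v (y, s) = V := by
    rw [Measure.volume_eq_prod] at hrv
    exact Measure.ae_ae_of_ae_prod hrv
  -- The mass coordinate integrates along a vertical line, so the constancy is needed at almost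
  -- every time on almost every such line.
  have h2 : ∀ᵐ q : ℝ × ℝ, ∀ᵐ s : ℝ, (q.1, s) ∈ upper₂ → r (q.1, s) = ρ₀ ∧ v (q.1, s) = V := by
    rw [Measure.volume_eq_prod]
    exact Measure.quasiMeasurePreserving_fst.ae h1
  filter_upwards [ae_restrict_of_ae h2, ae_restrict_mem measurableSet_upper₂] with q hq hqu
  have hq0 : 0 < q.2 := hqu
  have e1 : crossed (extMomentum r v) q =
      ∫ s in Iio q.2, (Ioo 0 q.2).indicator (fun _ => ρ₀ * V) s := by
    rw [crossed]
    refine setIntegral_congr_ae measurableSet_Iio ?_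
    filter_upwards [hq] with s hs hsq
    by_cases h0 : 0 < s
    · have hm : (q.1, s) ∈ upper₂ := h0
      rw [extMomentum, indicator_of_mem hm, indicator_of_mem (show s ∈ Ioo 0 q.2 from ⟨h0, hsq⟩),
        (hs hm).1, (hs hm).2]
    · have hm : (q.1, s) ∉ upper₂ := h0
      rw [extMomentum, indicator_of_notMem hm, indicator_of_notMem fun h : s ∈ Ioo 0 q.2 => h0 h.1]
  rw [massCoord, e1, setIntegral_indicator measurableSet_Ioo,
    inter_eq_self_of_subset_right (fun s hs => hs.2), setIntegral_const, Measure.real,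
    Real.volume_Ioo, sub_zero, ENNReal.toReal_ofReal hq0.le, smul_eq_mul]
  ring

end IsPlanarSolution

/-! ### Conclusion -/

theorem ae_ne_line (V : ℝ) : ∀ᵐ q : ℝ × ℝ, q.1 ≠ V * q.2 := by
  have hm : MeasurableSet {q : ℝ × ℝ | q.1 ≠ V * q.2} :=
    (measurableSet_eq_fun measurable_fst (measurable_snd.const_mul V)).compl
  rw [Measure.volume_eq_prod, Measure.ae_prod_iff_ae_ae hm]
  have h0 : ∀ᵐ y : ℝ, y ≠ 0 := by simp [ae_iff]
  filter_upwards [h0] with y hy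
  have h1 : ∀ᵐ t : ℝ, t ≠ y / V := by simp [ae_iff]
  filter_upwards [h1] with t ht
  intro h2
  have hV : V ≠ 0 := by
    rintro rfl
    exact hy (by simpa using h2)
  exact ht (by rw [h2]; field_simp)

end IsentropicEuler

open IsentropicEuler in
theorem theorem1p2 (p ε : ℝ → ℝ) (hp : IsPressureLaw p) (hε : IsInternalEnergy p ε)
    (sL sR : State) (hρ_pos : 0 < sR.ρ) (hρ : sR.ρ = sL.ρ) (hv₂ : sR.v₂ = sL.v₂)
    (hv₁ : sR.v₁ ≠ sL.v₁)
    (U : SpaceTime → State)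
    (hU : IsAdmissibleWeakSolution p ε (riemannData sL sR) U)
    (hU_one : IsOneDimensional U) (hU_inf : DensityBoundedBelow U) :
    ∀ᵐ z ∂upperMeasure, U z = singleJump sL sR sL.v₂ z := by
  have hρ0 : 0 < sL.ρ := hρ ▸ hρ_pos
  obtain ⟨c, M, r, w, v, h, hc, hM, hrep⟩ := exists_planarSolution hp hε hρ0 hU hU_one hU_inf
  have hw := h.ae_w_eq hρ hc hM
  have hw' : ∀ᵐ q ∂(volume.restrict upper₂), w q = sL.v₁ ∨ w q = sR.v₁ := by
    filter_upwards [hw] with q hq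
    rw [hq, jump]
    split_ifs
    · exact .inl rfl
    · exact .inr rfl
  have hrv := h.ae_r_v_eq hp hε hρ hc hM hv₂ hw'
  have hψ := IsPlanarSolution.ae_massCoord_eq hrv
  have key : ∀ᵐ q ∂(volume.restrict upper₂),
      (⟨r q, w q, v q⟩ : State) = if q.1 < sL.v₂ * q.2 then sL else sR := by
    filter_upwards [hw, hrv, hψ, ae_restrict_of_ae (ae_ne_line sL.v₂)] with q e1 e2 e3 e4
    rw [e1, e2.1, e2.2, e3]
    -- As ρ₀ > 0, the mass coordinate ρ₀(y - Vt) changes sign exactly on the line y = Vt.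
    rcases lt_or_gt_of_ne e4 with hlt | hlt
    · rw [if_pos hlt, jump, if_pos (mul_nonpos_of_nonneg_of_nonpos hρ0.le (by linarith))]
    · rw [if_neg (not_lt.2 hlt.le), jump, if_neg (not_le.2 (mul_pos hρ0 (by linarith))),
        ← hρ, ← hv₂]
  filter_upwards [hrep, quasiMeasurePreserving_proj.ae key] with z h1 h2
  rw [h1, h2]
  rfl
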